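/- Let $k$ be a field of characteristic different from $2$, let $\mathfrak C$ be an octonion algebra over $k$ with norm $N$ (a unital, not necessarily associative, $8$-dimensional $k$-algebra with a nondegenerate quadratic form $N$ satisfying $N(xy)=N(x)N(y)$), and let $G(k)=\mathrm{Aut}_k(\mathfrak C)$ be its group of $k$-algebra automorphisms. Let $L\subset\mathfrak C$ be a quadratic étale subalgebra, and let $t_0\in G(k)$ be semisimple (that is, diagonalizable on $\mathfrak C\otimes_k\bar k$) and fix $L$ pointwise. Define $A$ as follows. - If $L$ is a field, then $L^\perp$ (the orthogonal complement of $L$ with respect to $N$) is a $3$-dimensional left $L$-vector space via multiplication in $\mathfrak C$, and $A=t_0|_{L^\perp}$, regarded as an $L$-linear map. - If $L\cong k\times k$, choose an idempotent $e\in L$ with $e\neq 0,1$, put $U=\{x\in\mathfrak C : ex=0,\ xe=x\}$, a $3$-dimensional $k$-vector space, and let $A=t_0|_U$, regarded as a $k$-linear map. (These are the images of $t_0$ in $SU(L^\perp,h)$ and in $SL(U)\cong SL(3)$, respectively, where $h$ is the hermitian form on $L^\perp$ induced by $N$.) Assume that the characteristic polynomial of $A$, over $L$ in the first case and over $k$ in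 the second, is reducible. Then $t_0$ is a product of two involutions in $G(k)$, i.e. $t_0=gh$ with $g,h\in G(k)$ and $g^2=h^2=1$; in particular, $t_0$ is real, i.e. conjugate to $t_0^{-1}$ in $G(k)$. -/

import Mathlib

/-- A composition algebra over the field `k`: a unital, not necessarily associative `k`-algebra `C`
with a nondegenerate quadratic form (the norm) that permits composition. Nondegeneracy refers to
the bilinear form `N(x, y) = N(x + y) - N(x) - N(y)`. -/
class CompositionAlgebra (k C : Type*) [Field k] [NonAssocRing C] [Module k C]
    [IsScalarTower k C C] [SMulCommClass k C C] where
  norm : QuadraticForm k C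
  nondegenerate : norm.polarBilin.Nondegenerate
  norm_mul : ∀ x y : C, norm (x * y) = norm x * norm y

/-- An octonion algebra is a composition algebra of dimension `8`. -/
class OctonionAlgebra (k C : Type*) [Field k] [NonAssocRing C] [Module k C]
    [IsScalarTower k C C] [SMulCommClass k C C] extends CompositionAlgebra k C where
  finrank_eq : Module.finrank k C = 8

namespace CompositionAlgebra

variable {k C : Type*} [Field k] [NonAssocRing C] [Module k C]
  [IsScalarTower k C C] [SMulCommClass k C C]

section norm

variable [CompositionAlgebra k C]

variable (k) in
/-- The bilinear form `N(x, y) = N(x + y) - N(x) - N(y)` of the norm. -/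
def bilin : LinearMap.BilinForm k C := (norm (k := k) (C := C)).polarBilin

theorem bilin_apply (x y : C) :
    bilin k x y = norm (k := k) (x + y) - norm (k := k) x - norm (k := k) y := rfl

theorem bilin_comm (x y : C) : bilin k x y = bilin k y x := by
  rw [bilin_apply, bilin_apply, add_comm x y]; ring

theorem eq_of_bilin {x y : C} (h : ∀ z, bilin k x z = bilin k y z) : x = y := by
  have h1 : x - y = 0 := by
    refine (nondegenerate (k := k) (C := C)).1 (x - y) fun z => ?_
    have h2 := h z
    change bilin k (x - y) z = 0
    rw [map_sub, LinearMap.sub_apply, h2, sub_self]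
  exact sub_eq_zero.mp h1

theorem bilin_mul_mul (x y z : C) :
    bilin k (x * y) (x * z) = norm (k := k) x * bilin k y z := by
  rw [bilin_apply, bilin_apply, ← mul_add, norm_mul, norm_mul, norm_mul]; ring

theorem bilin_mul_add (x w y z : C) :
    bilin k (x * y) (w * z) + bilin k (w * y) (x * z) = bilin k x w * bilin k y z := by
  have h := bilin_mul_mul (k := k) (x + w) y z
  have h1 := bilin_mul_mul (k := k) x y z
  have h2 := bilin_mul_mul (k := k) w y z
  have h3 := bilin_apply (k := k) x w
  simp only [add_mul, map_add, LinearMap.add_apply] at h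
  rw [h3]
  linear_combination h - h1 - h2

theorem bilin_mul_left (x y z : C) :
    bilin k (x * y) z = bilin k x 1 * bilin k y z - bilin k y (x * z) := by
  have h := bilin_mul_add (k := k) x 1 y z
  simp only [one_mul] at h
  linear_combination h

theorem mul_mul_self (x y : C) :
    x * (x * y) = bilin k x 1 • (x * y) - norm (k := k) x • y := by
  refine eq_of_bilin (k := k) fun z => ?_
  have h := bilin_mul_left (k := k) x (x * y) z
  have h1 := bilin_mul_mul (k := k) x y z
  simp only [map_sub, map_smul, LinearMap.sub_apply, LinearMap.smul_apply, smul_eq_mul]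
  linear_combination h - h1

/-- The left alternative law. -/
theorem left_alternative (k : Type*) {C : Type*} [Field k] [NonAssocRing C] [Module k C]
    [IsScalarTower k C C] [SMulCommClass k C C] [CompositionAlgebra k C] (x y : C) : (x * x) * y = x * (x * y) := by
  have h := mul_mul_self (k := k) x (1 : C)
  rw [mul_one] at h
  rw [h, mul_mul_self (k := k) x y, sub_mul, smul_mul_assoc, smul_mul_assoc, one_mul]

end norm

variable (k C) in
/-- The group of `k`-algebra automorphisms of `C`. -/
def autGroup : Subgroup (C ≃ₗ[k] C) where
  carrier := {t | ∀ x y : C, t (x * y) = t x * t y}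
  mul_mem' {s t} hs ht x y := by
    change s (t (x * y)) = s (t x) * s (t y)
    rw [ht, hs]
  one_mem' _ _ := rfl
  inv_mem' {t} ht x y := by
    change t.symm (x * y) = t.symm x * t.symm y
    rw [LinearEquiv.symm_apply_eq, ht, LinearEquiv.apply_symm_apply, LinearEquiv.apply_symm_apply]

/-- Automorphisms preserve the norm. -/
theorem norm_apply [CompositionAlgebra k C] (t : autGroup k C) (x : C) :
    norm (k := k) ((t : C ≃ₗ[k] C) x) = norm (k := k) x := by
  obtain ⟨t, ht⟩ := t
  change norm (k := k) (t x) = norm (k := k) x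
  have ht' : ∀ x y : C, t (x * y) = t x * t y := ht
  have h1 : t (1 : C) = 1 := by
    have h := ht' (t.symm 1) 1
    rw [mul_one, LinearEquiv.apply_symm_apply, one_mul] at h
    exact h.symm
  by_cases hx : ∃ c : k, t x = c • (1 : C)
  · obtain ⟨c, hc⟩ := hx
    have : x = c • (1 : C) := by
      apply t.injective
      rw [hc, map_smul, h1]
    rw [hc, ← this]
  have ha := congrArg t (mul_mul_self (k := k) x (1 : C))
  have hb := mul_mul_self (k := k) (t x) (1 : C)
  rw [mul_one] at ha hb
  rw [ht', map_sub, map_smul, map_smul, h1, hb] at ha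
  have hd : (bilin k (t x) 1 - bilin k x 1) • t x =
      (norm (k := k) (t x) - norm (k := k) x) • (1 : C) := by
    rw [sub_smul, sub_smul, sub_eq_sub_iff_add_eq_add]
    rw [sub_eq_sub_iff_add_eq_add] at ha
    rw [ha, add_comm]
  by_cases h0 : bilin k (t x) 1 - bilin k x 1 = 0
  · rw [h0, zero_smul] at hd
    rcases smul_eq_zero.mp hd.symm with h | h
    · exact sub_eq_zero.mp h
    · exact (hx ⟨0, by rw [zero_smul, ← mul_one (t x), h, mul_zero]⟩).elim
  · refine (hx ⟨(bilin k (t x) 1 - bilin k x 1)⁻¹ *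
      (norm (k := k) (t x) - norm (k := k) x), ?_⟩).elim
    rw [mul_smul, ← hd, smul_smul, inv_mul_cancel₀ h0, one_smul]

theorem bilin_apply_apply [CompositionAlgebra k C] (t : autGroup k C) (x y : C) :
    bilin k ((t : C ≃ₗ[k] C) x) ((t : C ≃ₗ[k] C) y) = bilin k x y := by
  rw [bilin_apply, bilin_apply, ← map_add, norm_apply, norm_apply, norm_apply]

/-- An endomorphism of a vector space over `k` is semisimple (in the sense of algebraic groups) if
it becomes diagonalizable over an algebraic closure of `k`. -/
def IsGeometricallySemisimple (f : C →ₗ[k] C) : Prop :=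
  ⨆ μ : AlgebraicClosure k,
    Module.End.eigenspace (f.baseChange (AlgebraicClosure k)) μ = ⊤

end CompositionAlgebra

/-- A unital subalgebra of dimension `2`. -/
structure QuadraticSubalgebra (k C : Type*) [Field k] [NonAssocRing C] [Module k C]
    extends NonUnitalSubalgebra k C where
  one_mem' : (1 : C) ∈ carrier
  finrank_eq' : Module.finrank k toNonUnitalSubalgebra = 2

namespace QuadraticSubalgebra

open CompositionAlgebra

variable {k C : Type*} [Field k] [NonAssocRing C] [Module k C]

instance : CoeSort (QuadraticSubalgebra k C) (Type _) where
  coe L := L.toNonUnitalSubalgebra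

instance : Membership C (QuadraticSubalgebra k C) where
  mem L x := x ∈ L.toNonUnitalSubalgebra

variable (L : QuadraticSubalgebra k C)

/-- Of two elements of a quadratic subalgebra, either the first is a scalar or the second is a
combination of `1` and the first. -/
theorem exists_eq (a b : L) :
    (∃ c : k, (a : C) = c • (1 : C)) ∨ ∃ c d : k, (b : C) = c • (1 : C) + d • (a : C) := by
  by_cases h : ∃ c : k, (a : C) = c • (1 : C)
  · exact Or.inl h
  refine Or.inr ?_
  have h1 : (1 : C) ≠ 0 := by
    intro h0
    exact h ⟨0, by rw [zero_smul, ← mul_one (a : C), h0, mul_zero]⟩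
  let u : L := ⟨1, L.one_mem'⟩
  have hli : LinearIndependent k ![u, a] := by
    rw [LinearIndependent.pair_iff]
    intro s t hst
    have hst' : s • (1 : C) + t • (a : C) = 0 := congrArg Subtype.val hst
    have ht : t = 0 := by
      by_contra ht
      refine h ⟨-(t⁻¹ * s), ?_⟩
      have h2 : t • (a : C) = -(s • (1 : C)) := by
        rw [eq_neg_iff_add_eq_zero, add_comm]; exact hst'
      calc (a : C) = t⁻¹ • (t • (a : C)) := by rw [smul_smul, inv_mul_cancel₀ ht, one_smul]
        _ = -(t⁻¹ * s) • (1 : C) := by rw [h2, smul_neg, smul_smul, neg_smul]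
    subst ht
    rw [zero_smul, add_zero] at hst'
    exact ⟨(smul_eq_zero.mp hst').resolve_right h1, rfl⟩
  have hspan : Submodule.span k (Set.range ![u, a]) = ⊤ :=
    hli.span_eq_top_of_card_eq_finrank (by rw [Fintype.card_fin]; exact L.finrank_eq'.symm)
  have hb : b ∈ Submodule.span k (Set.range ![u, a]) := by rw [hspan]; trivial
  rw [Matrix.range_cons, Matrix.range_cons, Matrix.range_empty, Set.union_empty,
    Set.singleton_union, Submodule.mem_span_pair] at hb
  obtain ⟨c, d, hcd⟩ := hb
  exact ⟨c, d, (congrArg Subtype.val hcd).symm⟩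

section comm

variable [IsScalarTower k C C] [SMulCommClass k C C]

theorem mul_comm' (a b : L) : (a : C) * b = b * a := by
  rcases L.exists_eq a b with ⟨c, hc⟩ | ⟨c, d, hb⟩
  · rw [hc]; simp [smul_mul_assoc, mul_smul_comm]
  · rw [hb]; simp [mul_add, add_mul, smul_mul_assoc, mul_smul_comm]

theorem mul_assoc' (a b x : L) : ((a : C) * b) * x = a * (b * x) := by
  rcases L.exists_eq a b with ⟨c, hc⟩ | ⟨c, d, hb⟩
  · rw [hc]; simp [smul_mul_assoc]
  rcases L.exists_eq a x with ⟨c', hc⟩ | ⟨c', d', hx⟩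
  · rw [hc]; simp [smul_mul_assoc]
  · have h : ((a : C) * a) * a = a * (a * a) := by
      have := L.mul_comm' (a * a) a
      simpa using this
    rw [hb, hx]
    simp only [mul_add, add_mul, mul_smul_comm, smul_mul_assoc, mul_one, one_mul, h]

/-- A quadratic subalgebra is commutative and associative; its operations are those of `C`. -/
instance : CommRing L :=
  { (inferInstance : NonUnitalNonAssocRing L.toNonUnitalSubalgebra) with
    one := ⟨1, L.one_mem'⟩
    one_mul := fun a => Subtype.ext (one_mul (a : C))
    mul_one := fun a => Subtype.ext (mul_one (a : C))
    mul_comm := fun a b => Subtype.ext (L.mul_comm' a b)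
    mul_assoc := fun a b c => Subtype.ext (L.mul_assoc' a b c) }

theorem coe_one : ((1 : L) : C) = 1 := rfl

theorem coe_mul (a b : L) : ((a * b : L) : C) = (a : C) * (b : C) := rfl

instance : Algebra k L :=
  Algebra.ofModule (fun c a b => Subtype.ext (smul_mul_assoc c (a : C) (b : C)))
    (fun c a b => Subtype.ext (mul_smul_comm c (a : C) (b : C)))

end comm

variable [IsScalarTower k C C] [SMulCommClass k C C] [CompositionAlgebra k C]

theorem mul_mul (a b : L) (v : C) : ((a : C) * b) * v = a * (b * v) := by
  rcases L.exists_eq a b with ⟨c, hc⟩ | ⟨c, d, hb⟩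
  · rw [hc]; simp [smul_mul_assoc]
  · rw [hb]
    simp only [mul_add, add_mul, mul_smul_comm, smul_mul_assoc, mul_one, one_mul,
      left_alternative k (a : C) v]

/-- The orthogonal complement of `L` with respect to the bilinear form of the norm. -/
def perp : Submodule k C where
  carrier := {v | ∀ a : L, bilin k (a : C) v = 0}
  zero_mem' a := map_zero _
  add_mem' hv hw a := by rw [map_add, hv a, hw a, add_zero]
  smul_mem' c v hv a := by rw [map_smul, hv a, smul_zero]

theorem mul_mem_perp (a : L) {v : C} (hv : v ∈ L.perp) : (a : C) * v ∈ L.perp := by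
  intro b
  have h := bilin_mul_left (k := k) (a : C) v b
  have h1 : bilin k (b : C) v = 0 := hv b
  have h2 : bilin k ((a : C) * b) v = 0 := hv (a * b)
  rw [bilin_comm, h, bilin_comm v, bilin_comm v, h1, h2, mul_zero, sub_zero]

/-- The `L`-module structure of `L^⊥`, by left multiplication in `C`. -/
instance : Module L L.perp where
  smul a v := ⟨(a : C) * v, L.mul_mem_perp a v.2⟩
  one_smul v := Subtype.ext (one_mul (v : C))
  mul_smul a b v := Subtype.ext (L.mul_mul a b v)
  smul_zero a := Subtype.ext (mul_zero (a : C))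
  smul_add a v w := Subtype.ext (mul_add (a : C) v w)
  add_smul a b v := Subtype.ext (add_mul (a : C) b v)
  zero_smul v := Subtype.ext (zero_mul (v : C))

theorem coe_smul (a : L) (v : L.perp) : ((a • v : L.perp) : C) = (a : C) * v := rfl

instance : IsScalarTower k L L.perp where
  smul_assoc c a v := Subtype.ext (smul_mul_assoc c (a : C) (v : C))

/-- The subgroup `G(C/L)` of the automorphisms of `C` that fix `L` pointwise. -/
def fixingSubgroup : Subgroup (autGroup k C) where
  carrier := {t | ∀ a : L, (t : C ≃ₗ[k] C) (a : C) = a}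
  mul_mem' {s t} hs ht a := by
    change (s : C ≃ₗ[k] C) ((t : C ≃ₗ[k] C) (a : C)) = a
    rw [ht a, hs a]
  one_mem' _ := rfl
  inv_mem' {t} ht a := by
    change (t : C ≃ₗ[k] C).symm (a : C) = a
    rw [LinearEquiv.symm_apply_eq, ht a]

/-- The map `v ↦ t v` on `L^⊥` induced by an automorphism `t` fixing `L` pointwise; it is
`L`-linear. -/
def restrictPerp (t : L.fixingSubgroup) : L.perp →ₗ[L] L.perp where
  toFun v := ⟨(t : C ≃ₗ[k] C) v, fun a => by
    have h := bilin_apply_apply (t : autGroup k C) (a : C) (v : C)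
    rw [t.2 a] at h
    rw [h]
    exact v.2 a⟩
  map_add' v w := Subtype.ext (map_add (t : C ≃ₗ[k] C) (v : C) w)
  map_smul' a v := Subtype.ext <| by
    have h := (t : autGroup k C).2 (a : C) (v : C)
    rw [t.2 a] at h
    exact h

/-- The Peirce component `{x ∣ e x = 0, x e = x}` of an element `e` of `C`. -/
def peirce (k : Type*) [Field k] [Module k C] [IsScalarTower k C C] [SMulCommClass k C C]
    (e : C) : Submodule k C where
  carrier := {x | e * x = 0 ∧ x * e = x}
  zero_mem' := ⟨mul_zero e, zero_mul e⟩
  add_mem' hx hy := ⟨by rw [mul_add, hx.1, hy.1, add_zero], by rw [add_mul, hx.2, hy.2]⟩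
  smul_mem' c x hx := ⟨by rw [mul_smul_comm, hx.1, smul_zero], by rw [smul_mul_assoc, hx.2]⟩

/-- The `k`-linear map `x ↦ t x` on the Peirce component of an element `e` of `L`, induced by an
automorphism `t` fixing `L` pointwise. -/
def restrictPeirce (t : L.fixingSubgroup) (e : L) : peirce k (e : C) →ₗ[k] peirce k (e : C) :=
  ((t : C ≃ₗ[k] C) : C →ₗ[k] C).restrict fun x hx => by
    have h1 := (t : autGroup k C).2 (e : C) x
    have h2 := (t : autGroup k C).2 x (e : C)
    rw [t.2 e, hx.1, map_zero] at h1
    rw [t.2 e, hx.2] at h2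
    exact ⟨h1.symm, h2.symm⟩

theorem free_perp (h : IsField L) : Module.Free L L.perp := by
  let _ := h.toField
  exact Module.Free.of_divisionRing L L.perp

end QuadraticSubalgebra

namespace OctonionAlgebra

variable {k C : Type*} [Field k] [NonAssocRing C] [Module k C]
  [IsScalarTower k C C] [SMulCommClass k C C] [OctonionAlgebra k C]

variable (k C) in
theorem finite : Module.Finite k C :=
  Module.finite_of_finrank_pos (by rw [OctonionAlgebra.finrank_eq]; norm_num)

end OctonionAlgebra

namespace QuadraticSubalgebra

open CompositionAlgebra

variable {k C : Type*} [Field k] [NonAssocRing C] [Module k C]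
  [IsScalarTower k C C] [SMulCommClass k C C] [OctonionAlgebra k C]
  (L : QuadraticSubalgebra k C)

instance : Module.Finite L L.perp :=
  haveI := OctonionAlgebra.finite k C
  Module.Finite.of_restrictScalars_finite k L L.perp

/-- For a quadratic field `L`: the characteristic polynomial over `L` of the `L`-linear map on
`L^⊥` induced by `t`. -/
noncomputable def charpolyPerp (hL : IsField L) (t : L.fixingSubgroup) : Polynomial L :=
  haveI := L.free_perp hL
  (L.restrictPerp t).charpoly

/-- For an idempotent `e` of `L`: the characteristic polynomial over `k` of the `k`-linear map on
the Peirce component of `e` induced by `t`. -/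
noncomputable def charpolyPeirce (t : L.fixingSubgroup) (e : L) : Polynomial k :=
  haveI := OctonionAlgebra.finite k C
  (L.restrictPeirce t e).charpoly

end QuadraticSubalgebra

/-! It suffices to find an involution ρ with (tρ)² = 1: then t = (tρ)ρ, and ρ conjugates t to its
inverse.

A reducible characteristic polynomial of degree at most 3 has a root, so A has an eigenvector.
Semisimplicity turns it into an anisotropic v in L^⊥ with t v = a v for some a in L, hence ā a = 1
(`exists_anisotropic_eigenvector_of_isField`, `exists_anisotropic_eigenvector_of_idempotent`). If
the given eigenvector is isotropic, its eigenspace pairs nontrivially with another one, and an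
anisotropic eigenvector is built from the pair.

Choose b in L^⊥, anisotropic and hermitian-orthogonal to v. Then C = L ⊕ Lv ⊕ Lb ⊕ L(vb), and t b =
x b + y(vb) with x, y in L. Let ρ be the reflection in the quaternion algebra spanned by 1, v, b, vb
(`exists_involution`): it fixes v and b and restricts to conjugation on L. Then (tρ)² fixes L and v,
and it fixes b as soon as y = -ȳ ā (`exists_inverting_involution_of_eq_neg`). If y is invertible,
this condition is reached by rescaling v by an element of L found with Hilbert 90; if y = 0 it holds
trivially.

When L is a field, y is always zero or invertible. When L is split, y can be a zero divisor, and b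
is then replaced by a vector w + t(vw), with w in one Peirce component, for which y is invertible
(`exists_inverting_involution_of_bilin_ne_zero`). -/

namespace CompositionAlgebra

/-! ### Alternative and Moufang identities -/

section identities

variable {k C : Type*} [Field k] [NonAssocRing C] [Module k C]
  [IsScalarTower k C C] [SMulCommClass k C C] [CompositionAlgebra k C]

theorem norm_add (x y : C) :
    norm (k := k) (x + y) = norm (k := k) x + norm (k := k) y + bilin k x y := by
  rw [bilin_apply]; ring

theorem norm_smul (c : k) (x : C) : norm (k := k) (c • x) = c * c * norm (k := k) x := by
  rw [QuadraticMap.map_smul, smul_eq_mul]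

theorem bilin_self (x : C) : bilin k x x = 2 * norm (k := k) x := by
  have h := norm_add (k := k) x x
  rw [← two_smul k x, norm_smul] at h
  linear_combination -h

theorem norm_one_of_norm_ne_zero {x : C} (hx : norm (k := k) x ≠ 0) :
    norm (k := k) (1 : C) = 1 := by
  have h := norm_mul (k := k) (1 : C) x
  rw [one_mul] at h
  exact mul_right_cancel₀ hx (by rw [one_mul]; exact h.symm)

theorem bilin_mul_mul_right (x y z : C) :
    bilin k (y * x) (z * x) = bilin k y z * norm (k := k) x := by
  rw [bilin_apply, bilin_apply, ← add_mul, norm_mul, norm_mul, norm_mul]; ring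

theorem mul_mul_add_mul_mul (x y z : C) :
    x * (y * z) + y * (x * z) =
      bilin k x 1 • (y * z) + bilin k y 1 • (x * z) - bilin k x y • z := by
  have h := mul_mul_self (k := k) (x + y) z
  have hx := mul_mul_self (k := k) x z
  have hy := mul_mul_self (k := k) y z
  simp only [add_mul, mul_add, norm_add, map_add, LinearMap.add_apply] at h
  rw [hx, hy] at h
  linear_combination (norm := module) h

theorem mul_add_mul (x y : C) :
    x * y + y * x = bilin k x 1 • y + bilin k y 1 • x - bilin k x y • (1 : C) := by
  simpa using mul_mul_add_mul_mul (k := k) x y 1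

theorem mul_self (x : C) : x * x = bilin k x 1 • x - norm (k := k) x • (1 : C) := by
  simpa using mul_mul_self (k := k) x 1

/-- The right alternative law follows from the left one: the term y(xy) is eliminated between two
linearised left identities. -/
theorem mul_mul_self_right (x y : C) :
    (x * y) * y = bilin k y 1 • (x * y) - norm (k := k) y • x := by
  have h1 := mul_add_mul (k := k) (x * y) y
  have h2 := mul_mul_add_mul_mul (k := k) x y y
  have h3 := mul_self (k := k) y
  have h4 := bilin_mul_left (k := k) x y 1
  have h5 := bilin_mul_mul_right (k := k) y x 1
  rw [one_mul] at h5
  rw [mul_one, bilin_comm y x] at h4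
  rw [h3, mul_sub, mul_smul_comm, mul_smul_comm, mul_one] at h2
  rw [h4, h5] at h1
  linear_combination (norm := module) h1 - h2

/-- The left Moufang identity. -/
theorem moufang (k : Type*) {C : Type*} [Field k] [NonAssocRing C] [Module k C]
    [IsScalarTower k C C] [SMulCommClass k C C] [CompositionAlgebra k C] (a x z : C) :
    a * (x * (a * z)) = (a * x * a) * z := by
  have h1 := mul_mul_add_mul_mul (k := k) x a z
  have h2 : x * (a * z) = bilin k x 1 • (a * z) + bilin k a 1 • (x * z) - bilin k x a • z
      - a * (x * z) := by rw [← h1]; abel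
  have h3 := mul_add_mul (k := k) (a * x) a
  have h4 : a * x * a = bilin k (a * x) 1 • a + bilin k a 1 • (a * x)
      - bilin k (a * x) a • (1 : C) - a * (a * x) := by rw [← h3]; abel
  have h5 := bilin_mul_left (k := k) a x 1
  have h6 := bilin_mul_mul (k := k) a x 1
  rw [mul_one] at h5 h6
  rw [h2, h4, h5, h6]
  simp only [mul_sub, mul_add, sub_mul, add_mul, mul_smul_comm, smul_mul_assoc, one_mul,
    mul_mul_self (k := k) a]
  module

/-- The Moufang identity with z = ay, where a(ay) = -N(a)y. Left multiplication by a is thus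
multiplicative up to changing the map on the first factor to x ↦ axa; composing several such maps
can make the two agree. -/
theorem norm_smul_mul_mul {a : C} (ha : bilin k a 1 = 0) (x y : C) :
    -norm (k := k) a • (a * (x * y)) = (a * x * a) * (a * y) := by
  have h := moufang k a x (a * y)
  rw [mul_mul_self (k := k) a y, ha, zero_smul, zero_sub, mul_neg, mul_neg, mul_smul_comm,
    mul_smul_comm] at h
  rw [← h, neg_smul]

theorem mul_mul_self_of_pure {a : C} (ha : bilin k a 1 = 0) (x : C) :
    a * (a * x) = -norm (k := k) a • x := by
  rw [mul_mul_self (k := k) a x, ha, zero_smul, zero_sub, neg_smul]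

theorem mul_mul_anticomm {a b : C} (ha : bilin k a 1 = 0) (hb : bilin k b 1 = 0)
    (hab : bilin k a b = 0) (x : C) : a * (b * x) = -(b * (a * x)) := by
  have h := mul_mul_add_mul_mul (k := k) a b x
  rw [ha, hb, hab] at h
  simp only [zero_smul, add_zero, sub_zero] at h
  exact eq_neg_of_add_eq_zero_left h

theorem mul_anticomm {a b : C} (ha : bilin k a 1 = 0) (hb : bilin k b 1 = 0)
    (hab : bilin k a b = 0) : a * b = -(b * a) := by
  simpa using mul_mul_anticomm ha hb hab (1 : C)

theorem bilin_mul_one {a b : C} (ha : bilin k a 1 = 0) (hab : bilin k a b = 0) :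
    bilin k (a * b) 1 = 0 := by
  rw [bilin_mul_left, ha, zero_mul, mul_one, bilin_comm, hab, sub_zero]

theorem bilin_left_mul {a b : C} (hb : bilin k b 1 = 0) : bilin k a (a * b) = 0 := by
  have h := bilin_mul_mul (k := k) a 1 b
  rwa [mul_one, bilin_comm 1 b, hb, mul_zero] at h

theorem bilin_right_mul {a b : C} (ha : bilin k a 1 = 0) : bilin k b (a * b) = 0 := by
  have h := bilin_mul_mul_right (k := k) b 1 a
  rwa [one_mul, bilin_comm 1 a, ha, zero_mul] at h

/-- If `j` is orthogonal to the algebra generated by the pure elements `v` and `b`, then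
`(v b) j = - v (b j)`. -/
theorem mul_mul_eq_neg {v b j : C} (hv : bilin k v 1 = 0) (hb : bilin k b 1 = 0)
    (hvb : bilin k v b = 0)
    (hj : bilin k j 1 = 0) (hjv : bilin k j v = 0) (hjb : bilin k j b = 0)
    (hjvb : bilin k j (v * b) = 0) : (v * b) * j = -(v * (b * j)) := by
  have h1 := mul_anticomm (bilin_mul_one hv hvb) hj ((bilin_comm _ _).trans hjvb)
  have h2 := mul_mul_anticomm (k := k) hj hv hjv b
  have h3 := mul_anticomm hj hb hjb
  rw [h1, h2, h3, mul_neg, neg_neg]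

end identities

/-! ### Reflections in quaternion subalgebras -/

section involution

variable {k C : Type*} [Field k] [NonAssocRing C] [Module k C]
  [IsScalarTower k C C] [SMulCommClass k C C] [CompositionAlgebra k C]

/-- Two orthogonal anisotropic pure elements generate a quaternion subalgebra; the reflection in it
is an involutive automorphism. -/
theorem exists_involution {v b : C} (hv : bilin k v 1 = 0) (hb : bilin k b 1 = 0)
    (hvb : bilin k v b = 0) (hNv : norm (k := k) v ≠ 0) (hNb : norm (k := k) b ≠ 0) :
    ∃ ρ : autGroup k C, ρ ^ 2 = 1 ∧ (ρ : C ≃ₗ[k] C) v = v ∧ (ρ : C ≃ₗ[k] C) b = b ∧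
      ∀ j : C, bilin k j 1 = 0 → bilin k j v = 0 → bilin k j b = 0 → bilin k j (v * b) = 0 →
        (ρ : C ≃ₗ[k] C) j = -j := by
  set n : k := norm (k := k) v * norm (k := k) b with hn
  have hn0 : n ≠ 0 := mul_ne_zero hNv hNb
  have hw : bilin k (v * b) 1 = 0 := bilin_mul_one hv hvb
  have hNw : norm (k := k) (v * b) = n := norm_mul v b
  have hvw : bilin k v (v * b) = 0 := bilin_left_mul hb
  have hbw : bilin k b (v * b) = 0 := bilin_right_mul hv
  have hvv := mul_mul_self_of_pure (k := k) hv
  have hbb := mul_mul_self_of_pure (k := k) hb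
  have hww := mul_mul_self_of_pure (k := k) hw
  have hbv : b * v = -(v * b) := mul_anticomm hb hv ((bilin_comm _ _).trans hvb)
  -- The composite of the left multiplications by v, b and vb acts as -n on the quaternion algebra
  -- and as n on its orthogonal complement, so -n⁻¹M is the reflection.
  let M : C →ₗ[k] C := LinearMap.mulLeft k v ∘ₗ LinearMap.mulLeft k b ∘ₗ LinearMap.mulLeft k (v * b)
  have hM : ∀ x, M x = v * (b * ((v * b) * x)) := fun _ => rfl
  have hMM : ∀ x, M (M x) = (n * n) • x := by
    intro x
    rw [hM, hM, mul_mul_anticomm hw hv ((bilin_comm _ _).trans hvw) (b * (v * b * x)), mul_neg,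
      mul_neg, mul_mul_anticomm hb hv ((bilin_comm _ _).trans hvb), mul_neg, neg_neg, hvv,
      mul_mul_anticomm hw hb ((bilin_comm _ _).trans hbw), mul_neg, hww, hbb, hNw, smul_neg]
    simp only [smul_smul, hn, ← neg_smul]
    congr 1; ring
  have hM1 : M 1 = -n • (1 : C) := by
    have h : v * b = -(b * v) := by rw [hbv, neg_neg]
    rw [hM, mul_one, show b * (v * b) = norm (k := k) b • v by
        rw [h, mul_neg, hbb, neg_smul, neg_neg], mul_smul_comm, mul_self (k := k) v, hv, zero_smul,
      zero_sub, smul_neg, smul_smul, hn, neg_smul, mul_comm]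
  have hmul : ∀ x y, M (x * y) = -n⁻¹ • (M x * M y) := by
    -- Three uses of the Moufang identity give n² M(xy) = -T(x) M(y). Since M(1) = -n, taking y = 1
    -- identifies T with nM, and M becomes multiplicative up to a scalar.
    let T : C → C := fun x => v * (b * (v * b * x * (v * b)) * b) * v
    have hT : ∀ x y, (n * n) • M (x * y) = -(T x * M y) := by
      intro x y
      have h1 := norm_smul_mul_mul (k := k) hw x y
      have h2 := norm_smul_mul_mul (k := k) hb (v * b * x * (v * b)) (v * b * y)
      have h3 := norm_smul_mul_mul (k := k) hv (b * (v * b * x * (v * b)) * b) (b * (v * b * y))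
      rw [← h1] at h2
      simp only [mul_smul_comm] at h2
      rw [← h2] at h3
      simp only [mul_smul_comm, smul_smul] at h3
      change _ = -((v * (b * (v * b * x * (v * b)) * b) * v) * (v * (b * (v * b * y))))
      rw [← h3, hM, hNw, ← neg_smul]
      congr 1
      rw [hn]; ring
    have hT1 : ∀ x, T x = n • M x := by
      intro x
      have h := hT x 1
      rw [mul_one, hM1, mul_smul_comm, mul_one, ← neg_smul, neg_neg, mul_smul] at h
      exact (smul_right_injective C hn0 h).symm
    intro x y
    have h := hT x y
    rw [hT1, smul_mul_assoc, mul_smul, ← smul_neg] at h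
    rw [neg_smul, ← smul_neg, ← smul_right_injective C hn0 h, smul_smul, inv_mul_cancel₀ hn0,
      one_smul]
  let R : C →ₗ[k] C := -n⁻¹ • M
  have hR : ∀ x, R x = -n⁻¹ • M x := fun _ => rfl
  have hRR : Function.Involutive R := by
    intro x
    rw [hR, hR, map_smul, hMM, smul_smul, smul_smul]
    convert one_smul k x using 2
    field_simp
  have hRM : ∀ x y, M x = -n • y → R x = y := by
    intro x y h
    rw [hR, h, smul_smul, neg_mul_neg, inv_mul_cancel₀ hn0, one_smul]
  refine ⟨⟨LinearEquiv.ofInvolutive R hRR, fun x y => ?_⟩, ?_, ?_, ?_, ?_⟩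
  · change R (x * y) = R x * R y
    rw [hR, hR, hR, hmul, smul_mul_smul_comm, smul_smul]
  · rw [pow_two]
    ext x
    exact hRR x
  · apply hRM
    rw [hM, mul_anticomm hw hv ((bilin_comm _ _).trans hvw), hvv, neg_smul, neg_neg,
      mul_smul_comm, mul_self (k := k) b, hb, zero_smul, zero_sub, smul_neg, smul_smul, mul_neg,
      mul_smul_comm, mul_one, neg_smul]
  · apply hRM
    rw [hM, mul_mul_self_right (k := k) v b, hb, zero_smul, zero_sub, mul_neg, mul_smul_comm, hbv,
      smul_neg, neg_neg, mul_smul_comm, hvv, smul_smul, hn, mul_neg, mul_comm]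
  · intro j hj hjv hjb hjvb
    change R j = -j
    apply hRM
    rw [hM, mul_mul_eq_neg hv hb hvb hj hjv hjb hjvb, mul_neg, mul_neg,
      mul_mul_anticomm hb hv ((bilin_comm _ _).trans hvb), mul_neg, neg_neg, hvv, hbb, smul_smul,
      neg_mul_neg, neg_smul, smul_neg, neg_neg]

end involution

end CompositionAlgebra

/-! ### Semisimple endomorphisms -/

namespace Module.End

/-- The product of X - μ over the finitely many eigenvalues is squarefree and kills every
eigenspace. -/
theorem isSemisimple_of_iSup_eigenspace_eq_top {K V : Type*} [Field K] [AddCommGroup V]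
    [Module K V] [FiniteDimensional K V] {g : Module.End K V}
    (h : ⨆ μ : K, g.eigenspace μ = ⊤) : g.IsSemisimple := by
  classical
  have hfin := finite_hasEigenvalue g
  let P : Polynomial K := ∏ μ ∈ hfin.toFinset, (Polynomial.X - Polynomial.C μ)
  have hP : P.Separable :=
    Polynomial.separable_prod_X_sub_C_iff'.2 fun _ _ _ _ h => h
  refine isSemisimple_of_squarefree_aeval_eq_zero hP.squarefree ?_
  rw [← LinearMap.ker_eq_top, eq_top_iff, ← h, iSup_le_iff]
  intro μ x hx
  rw [LinearMap.mem_ker]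
  by_cases hx0 : x = 0
  · rw [hx0, map_zero]
  have hv : g.HasEigenvector μ x := ⟨hx, hx0⟩
  rw [Module.End.aeval_apply_of_hasEigenvector hv]
  have : P.eval μ = 0 := by
    rw [Polynomial.eval_prod]
    exact Finset.prod_eq_zero (hfin.mem_toFinset.2 (hasEigenvalue_of_hasEigenvector hv)) (by simp)
  rw [this, zero_smul]

theorem IsSemisimple.apply_eq_zero_of_apply_apply_eq_zero {K V : Type*} [Field K] [AddCommGroup V]
    [Module K V] {g : Module.End K V} (hg : g.IsSemisimple) {x : V} (hx : g (g x) = 0) :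
    g x = 0 := by
  have h := hg.isFinitelySemisimple.genEigenspace_eq_eigenspace (0 : K) (k := 2) (by norm_num)
  have h1 : x ∈ g.genEigenspace 0 2 := by
    rw [show (2 : ℕ∞) = ((2 : ℕ) : ℕ∞) from rfl, mem_genEigenspace_nat]
    simpa [pow_two] using hx
  rw [h, eigenspace_zero] at h1
  exact h1

end Module.End

namespace CompositionAlgebra

open TensorProduct in
/-- The polynomials in a geometrically semisimple endomorphism have no nilpotent part. -/
theorem IsGeometricallySemisimple.aeval_apply_eq_zero {k C : Type*} [Field k] [NonAssocRing C]
    [Module k C] [FiniteDimensional k C] {f : C →ₗ[k] C} (hf : IsGeometricallySemisimple f)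
    (p : Polynomial k) {x : C}
    (hx : Polynomial.aeval f p (Polynomial.aeval f p x) = 0) : Polynomial.aeval f p x = 0 := by
  let K := AlgebraicClosure k
  have hs : Module.End.IsSemisimple (f.baseChange K) :=
    Module.End.isSemisimple_of_iSup_eigenspace_eq_top hf
  have hp := hs.aeval (p.map (algebraMap k K))
  have hb : Polynomial.aeval (f.baseChange K) (p.map (algebraMap k K)) =
      (Polynomial.aeval f p).baseChange K := by
    rw [Polynomial.aeval_map_algebraMap]
    exact (Polynomial.aeval_algHom_apply (Module.End.baseChangeHom k K C) f p)
  rw [hb] at hp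
  have h1 := hp.apply_eq_zero_of_apply_apply_eq_zero (x := (1 : K) ⊗ₜ[k] x) (by
    rw [LinearMap.baseChange_tmul, LinearMap.baseChange_tmul, hx, tmul_zero])
  rw [LinearMap.baseChange_tmul] at h1
  exact (Module.FaithfullyFlat.one_tmul_eq_zero_iff k C _).1 h1

end CompositionAlgebra

/-! ### Orthogonal families of anisotropic vectors -/

namespace CompositionAlgebra

section orthogonal

variable {k C : Type*} [Field k] [NonAssocRing C] [Module k C]
  [IsScalarTower k C C] [SMulCommClass k C C] [CompositionAlgebra k C]
  {ι : Type*} [Fintype ι] {e : ι → C}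

theorem bilin_self_ne_zero (h2 : (2 : k) ≠ 0) {x : C} (hx : norm (k := k) x ≠ 0) :
    bilin k x x ≠ 0 := by
  rw [bilin_self]; exact mul_ne_zero h2 hx

theorem bilin_sum_smul (he : ∀ i j, i ≠ j → bilin k (e i) (e j) = 0) (g : ι → k) (i : ι) :
    bilin k (∑ j, g j • e j) (e i) = g i * bilin k (e i) (e i) := by
  rw [map_sum, LinearMap.sum_apply, Finset.sum_eq_single i]
  · rw [map_smul, LinearMap.smul_apply, smul_eq_mul]
  · intro j _ hj
    rw [map_smul, LinearMap.smul_apply, he j i hj, smul_zero]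
  · exact fun h => (h (Finset.mem_univ i)).elim

theorem linearIndependent_of_orthogonal (h2 : (2 : k) ≠ 0)
    (he : ∀ i j, i ≠ j → bilin k (e i) (e j) = 0) (hN : ∀ i, norm (k := k) (e i) ≠ 0) :
    LinearIndependent k e := by
  rw [Fintype.linearIndependent_iff]
  intro g hg i
  have h := bilin_sum_smul (k := k) he g i
  rw [hg, map_zero, LinearMap.zero_apply] at h
  exact (mul_eq_zero.mp h.symm).resolve_right (bilin_self_ne_zero h2 (hN i))

/-- The component of `x` orthogonal to an orthogonal family. -/
theorem bilin_sub_sum_eq_zero (h2 : (2 : k) ≠ 0)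
    (he : ∀ i j, i ≠ j → bilin k (e i) (e j) = 0) (hN : ∀ i, norm (k := k) (e i) ≠ 0) (x : C)
    (i : ι) :
    bilin k (x - ∑ j, (bilin k x (e j) * (bilin k (e j) (e j))⁻¹) • e j) (e i) = 0 := by
  rw [map_sub, LinearMap.sub_apply, bilin_sum_smul he,
    inv_mul_cancel_right₀ (bilin_self_ne_zero h2 (hN i)), sub_self]

/-- An orthogonal family of anisotropic vectors that is too small to span can be enlarged. -/
theorem exists_orthogonal_norm_ne_zero (h2 : (2 : k) ≠ 0)
    (he : ∀ i j, i ≠ j → bilin k (e i) (e j) = 0) (hN : ∀ i, norm (k := k) (e i) ≠ 0)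
    (hc : Fintype.card ι < Module.finrank k C) :
    ∃ b : C, (∀ i, bilin k b (e i) = 0) ∧ norm (k := k) b ≠ 0 := by
  by_contra! hcon
  -- P is the projection to the orthogonal complement of the family. If that complement contains
  -- only isotropic vectors, polarization makes the bilinear form vanish on it, so P = 0 by
  -- nondegeneracy and the family spans.
  let P : C → C := fun x => x - ∑ j, (bilin k x (e j) * (bilin k (e j) (e j))⁻¹) • e j
  have hP : ∀ x i, bilin k (P x) (e i) = 0 := bilin_sub_sum_eq_zero h2 he hN
  have h0 : ∀ x, P x = 0 := by
    intro x
    refine eq_of_bilin (k := k) fun z => ?_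
    have h1 : bilin k (P x) (P z) = 0 := by
      have h3 := norm_add (k := k) (P x) (P z)
      rw [hcon _ (hP x), hcon _ (hP z), hcon (P x + P z) fun i => by
        rw [map_add, LinearMap.add_apply, hP, hP, add_zero]] at h3
      simpa using h3.symm
    have h4 : ∀ y, (∀ i, bilin k y (e i) = 0) → bilin k y z = bilin k y (P z) := by
      intro y hy
      have h5 : P z = z - ∑ j, (bilin k z (e j) * (bilin k (e j) (e j))⁻¹) • e j := rfl
      rw [h5, map_sub, map_sum, Finset.sum_eq_zero, sub_zero]
      intro j _
      rw [map_smul, hy, smul_zero]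
    rw [h4 _ (hP x), h1, map_zero, LinearMap.zero_apply]
  have hspan : Submodule.span k (Set.range e) = ⊤ := by
    rw [eq_top_iff]
    intro x _
    rw [sub_eq_zero.mp (h0 x)]
    exact Submodule.sum_mem _ fun j _ => Submodule.smul_mem _ _ (Submodule.subset_span ⟨j, rfl⟩)
  have h5 := finrank_range_le_card (R := k) e
  rw [Set.finrank, hspan, finrank_top] at h5
  omega

theorem span_eq_top_of_orthogonal (h2 : (2 : k) ≠ 0)
    (he : ∀ i j, i ≠ j → bilin k (e i) (e j) = 0) (hN : ∀ i, norm (k := k) (e i) ≠ 0)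
    (hc : Fintype.card ι = Module.finrank k C) [Nonempty ι] :
    Submodule.span k (Set.range e) = ⊤ :=
  (linearIndependent_of_orthogonal h2 he hN).span_eq_top_of_card_eq_finrank hc

end orthogonal

end CompositionAlgebra

/-! ### Conjugation and hermitian orthogonality over L -/

namespace QuadraticSubalgebra

open CompositionAlgebra

section conj

variable {k C : Type*} [Field k] [NonAssocRing C] [Module k C]
  [IsScalarTower k C C] [SMulCommClass k C C] [CompositionAlgebra k C]
  (L : QuadraticSubalgebra k C)

/-- The conjugation `a ↦ N(a, 1) - a` of a quadratic subalgebra. -/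
def conj (a : L) : L := bilin k (a : C) 1 • 1 - a

theorem coe_conj (a : L) : (L.conj a : C) = bilin k (a : C) 1 • (1 : C) - a := rfl

theorem conj_mul (a b : L) : L.conj (a * b) = L.conj a * L.conj b := by
  apply Subtype.ext
  have h1 := mul_add_mul (k := k) (a : C) b
  have h2 := bilin_mul_left (k := k) (a : C) b 1
  rw [← L.mul_comm' a b, mul_one, bilin_comm (b : C) a] at *
  rw [coe_mul, coe_conj, coe_conj, coe_conj, coe_mul, h2]
  simp only [sub_mul, mul_sub, smul_mul_assoc, mul_smul_comm, one_mul, mul_one]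
  linear_combination (norm := module) -h1

theorem mul_conj (a : L) : a * L.conj a = norm (k := k) (a : C) • (1 : L) := by
  apply Subtype.ext
  change (a : C) * (bilin k (a : C) 1 • (1 : C) - a) = norm (k := k) (a : C) • (1 : C)
  rw [mul_sub, mul_smul_comm, mul_one, mul_self (k := k)]
  module

theorem bilin_mul_conj (a : L) (x y : C) :
    bilin k ((a : C) * x) y = bilin k x ((L.conj a : C) * y) := by
  rw [bilin_mul_left, coe_conj, sub_mul, smul_mul_assoc, one_mul, map_sub, map_smul, smul_eq_mul]

theorem bilin_one_of_mem_perp {v : C} (hv : v ∈ L.perp) : bilin k v 1 = 0 := by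
  rw [bilin_comm]; exact hv 1

/-- Multiplication by an element of `L^⊥` is conjugate linear. -/
theorem perp_mul_mul {v : C} (hv : v ∈ L.perp) (a : L) (y : C) :
    v * ((a : C) * y) = (L.conj a : C) * (v * y) := by
  have h := mul_mul_add_mul_mul (k := k) v (a : C) y
  rw [L.bilin_one_of_mem_perp hv, bilin_comm v, show bilin k (a : C) v = 0 from hv a] at h
  rw [coe_conj, sub_mul, smul_mul_assoc, one_mul]
  linear_combination (norm := module) h

theorem perp_mul {v : C} (hv : v ∈ L.perp) (a : L) : v * (a : C) = (L.conj a : C) * v := by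
  simpa using L.perp_mul_mul hv a 1

/-- `x` and `y` are orthogonal for the hermitian form over `L`. -/
def IsOrtho (x y : C) : Prop := ∀ a : L, bilin k x ((a : C) * y) = 0

variable {L}

theorem IsOrtho.bilin_mul_mul {x y : C} (h : L.IsOrtho x y) (a b : L) :
    bilin k ((a : C) * x) ((b : C) * y) = 0 := by
  rw [bilin_mul_conj, ← L.mul_mul]
  exact h (L.conj a * b)

theorem IsOrtho.mul_mul {x y : C} (h : L.IsOrtho x y) (a b : L) :
    L.IsOrtho ((a : C) * x) ((b : C) * y) := by
  intro c
  rw [← L.mul_mul]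
  exact h.bilin_mul_mul a (c * b)

theorem IsOrtho.symm {x y : C} (h : L.IsOrtho x y) : L.IsOrtho y x := by
  intro a
  have h1 := h.bilin_mul_mul a 1
  rw [coe_one, one_mul] at h1
  rw [bilin_comm, h1]

theorem IsOrtho.bilin_eq {x y : C} (h : L.IsOrtho x y) : bilin k x y = 0 := by
  simpa [coe_one] using h 1

theorem isOrtho_one_iff {x : C} : L.IsOrtho x 1 ↔ x ∈ L.perp := by
  refine forall_congr' fun a => ?_
  rw [mul_one, bilin_comm]

/-- Together with `perp_mul_mul`, this makes the product of hermitian-orthogonal elements of L^⊥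
conjugate linear in both factors. Anticommuting the factors reduces one statement to the other. -/
theorem mul_mul_of_isOrtho {v b : C} (hv : v ∈ L.perp) (hb : b ∈ L.perp) (h : L.IsOrtho b v)
    (a : L) : ((a : C) * v) * b = (L.conj a : C) * (v * b) := by
  rw [mul_anticomm (L.bilin_one_of_mem_perp (L.mul_mem_perp a hv)) (L.bilin_one_of_mem_perp hb)
    ((bilin_comm _ _).trans (h a)), L.perp_mul_mul hb, mul_anticomm (L.bilin_one_of_mem_perp hv)
    (L.bilin_one_of_mem_perp hb) h.symm.bilin_eq, mul_neg]

theorem mul_mem_perp_of_isOrtho {v b : C} (hv : v ∈ L.perp) (h : L.IsOrtho b v) :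
    v * b ∈ L.perp := by
  intro a
  rw [bilin_comm, bilin_mul_left, L.bilin_one_of_mem_perp hv, zero_mul, zero_sub, L.perp_mul hv,
    h, neg_zero]

theorem isOrtho_left_mul {v b : C} (hv : v ∈ L.perp) (hb : b ∈ L.perp) :
    L.IsOrtho v (v * b) := by
  intro a
  rw [bilin_comm, bilin_mul_conj, bilin_comm, ← L.perp_mul hv, CompositionAlgebra.bilin_mul_mul,
    hb a, mul_zero]

theorem isOrtho_right_mul {v b : C} (hv : v ∈ L.perp) (hb : b ∈ L.perp) (h : L.IsOrtho b v) :
    L.IsOrtho b (v * b) := by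
  intro a
  rw [bilin_comm, bilin_mul_conj, bilin_comm, ← L.perp_mul hb,
    mul_anticomm (L.bilin_one_of_mem_perp hv) (L.bilin_one_of_mem_perp hb) h.symm.bilin_eq,
    map_neg, CompositionAlgebra.bilin_mul_mul, hv a, mul_zero, neg_zero]

end conj

end QuadraticSubalgebra

namespace CompositionAlgebra

variable {k C : Type*} [Field k] [NonAssocRing C] [Module k C]

theorem autGroup_map_mul (t : autGroup k C) (x y : C) :
    (t : C ≃ₗ[k] C) (x * y) = (t : C ≃ₗ[k] C) x * (t : C ≃ₗ[k] C) y := t.2 x y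

theorem autGroup_map_one (t : autGroup k C) : (t : C ≃ₗ[k] C) 1 = 1 := by
  have h := t.2 ((t : C ≃ₗ[k] C).symm 1) 1
  rw [mul_one, LinearEquiv.apply_symm_apply, one_mul] at h
  exact h.symm

end CompositionAlgebra

namespace QuadraticSubalgebra

open CompositionAlgebra

/-! ### Decomposition of an octonion algebra over L -/

section octonion

variable {k C : Type*} [Field k] [NonAssocRing C] [Module k C]
  [IsScalarTower k C C] [SMulCommClass k C C] [OctonionAlgebra k C]

variable (k C) in
theorem norm_one : norm (k := k) (1 : C) = 1 := by
  have : Nontrivial C := Module.nontrivial_of_finrank_pos (R := k)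
    (by rw [OctonionAlgebra.finrank_eq]; norm_num)
  by_contra h
  have h0 : ∀ x : C, norm (k := k) x = 0 := by
    intro x
    by_contra hx
    exact h (norm_one_of_norm_ne_zero hx)
  refine one_ne_zero (α := C) (eq_of_bilin (k := k) fun z => ?_)
  rw [bilin_apply, h0, h0, h0, map_zero, LinearMap.zero_apply, sub_zero, sub_zero]

variable (k C) in
theorem bilin_one_one : bilin k (1 : C) 1 = 2 := by
  rw [bilin_self, norm_one, mul_one]

variable (L : QuadraticSubalgebra k C)

theorem conj_conj (a : L) : L.conj (L.conj a) = a := by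
  apply Subtype.ext
  rw [coe_conj, coe_conj, map_sub, map_smul, LinearMap.sub_apply, LinearMap.smul_apply,
    bilin_one_one, smul_eq_mul]
  module

theorem norm_conj (a : L) : norm (k := k) (L.conj a : C) = norm (k := k) (a : C) := by
  have h := norm_add (k := k) (bilin k (a : C) 1 • (1 : C)) (-(a : C))
  rw [← sub_eq_add_neg, ← coe_conj, CompositionAlgebra.norm_smul, norm_one, QuadraticMap.map_neg,
    map_neg, map_smul,
    LinearMap.smul_apply, smul_eq_mul, bilin_comm 1] at h
  rw [h]; ring

theorem exists_eq_smul_add (h2 : (2 : k) ≠ 0) {i : L} (hi : bilin k (i : C) 1 = 0) (hN : norm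
    (k := k) (i : C) ≠ 0)
    (a : L) : ∃ c d : k, (a : C) = c • (1 : C) + d • (i : C) := by
  rcases L.exists_eq i a with ⟨c, hc⟩ | h
  · rw [hc, map_smul, LinearMap.smul_apply, bilin_one_one, smul_eq_mul] at hi
    rw [hc, (mul_eq_zero.mp hi).resolve_right h2, zero_smul, map_zero] at hN
    exact (hN rfl).elim
  · exact h

section family

variable {ι : Type*} {w : ι → C}

/-- For i in L of trace zero, a hermitian-orthogonal family over L becomes an orthogonal family over
k when each w is doubled to w, iw. This carries the dimension counts from k to L: four vectors over
L against dimension 8 over k. -/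
theorem bilin_family {i : L} (hi : bilin k (i : C) 1 = 0)
    (hw : ∀ j j', j ≠ j' → L.IsOrtho (w j) (w j')) (p q : ι × Fin 2) (hpq : p ≠ q) :
    bilin k (((![1, i] p.2 : L) : C) * w p.1) (((![1, i] q.2 : L) : C) * w q.1) = 0 := by
  obtain ⟨j, s⟩ := p
  obtain ⟨j', s'⟩ := q
  by_cases hj : j = j'
  · subst hj
    change bilin k (((![1, i] s : L) : C) * w j) (((![1, i] s' : L) : C) * w j) = 0
    rw [CompositionAlgebra.bilin_mul_mul_right]
    fin_cases s <;> fin_cases s'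
    · exact (hpq rfl).elim
    · simp [coe_one, bilin_comm (1 : C), hi]
    · simp [coe_one, hi]
    · exact (hpq rfl).elim
  · exact (hw j j' hj).bilin_mul_mul _ _

theorem norm_family {i : L} (hN : norm (k := k) (i : C) ≠ 0)
    (hwN : ∀ j, norm (k := k) (w j) ≠ 0) (p : ι × Fin 2) :
    norm (k := k) (((![1, i] p.2 : L) : C) * w p.1) ≠ 0 := by
  obtain ⟨j, s⟩ := p
  rw [CompositionAlgebra.norm_mul]
  refine mul_ne_zero ?_ (hwN j)
  fin_cases s
  · simp [coe_one, norm_one]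
  · simpa using hN

end family

variable [Algebra.Etale k L]

/-- An isotropic element of trace zero has square zero. Since L is étale it is reduced, so the
traceless part of a nonscalar element is anisotropic. -/
theorem exists_pure (h2 : (2 : k) ≠ 0) :
    ∃ i : L, bilin k (i : C) 1 = 0 ∧ norm (k := k) (i : C) ≠ 0 := by
  obtain ⟨a, ha⟩ : ∃ a : L, ∀ c : k, c • (1 : L) ≠ a := by
    by_contra! h
    have h1 := finrank_le_one (R := k) (1 : L) h
    rw [L.finrank_eq'] at h1
    norm_num at h1
  let i : L := a - (bilin k (a : C) 1 / 2) • (1 : L)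
  have hi : bilin k (i : C) 1 = 0 := by
    change bilin k ((a : C) - (bilin k (a : C) 1 / 2) • (1 : C)) 1 = 0
    rw [map_sub, map_smul, LinearMap.sub_apply, LinearMap.smul_apply, bilin_one_one, smul_eq_mul,
      div_mul_cancel₀ _ h2, sub_self]
  refine ⟨i, hi, fun hN => ?_⟩
  have : IsReduced L := Algebra.FormallyUnramified.isReduced_of_field k L
  have h0 : i * i = 0 := by
    apply Subtype.ext
    rw [coe_mul, CompositionAlgebra.mul_self (k := k), hi, hN, zero_smul, zero_smul, sub_zero]
    rfl
  have h1 : i = 0 := IsReduced.eq_zero i ⟨2, by rw [pow_two, h0]⟩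
  exact ha _ (sub_eq_zero.mp h1).symm

theorem eq_zero_of_bilin (h2 : (2 : k) ≠ 0) {a : L} (h : ∀ c : L, bilin k (a : C)
    (c : C) = 0) : a = 0 := by
  obtain ⟨i, hi, hN⟩ := L.exists_pure h2
  obtain ⟨c, d, hcd⟩ := L.exists_eq_smul_add h2 hi hN a
  have h1 := h 1
  have h3 := h i
  rw [hcd, coe_one, map_add, map_smul, map_smul, LinearMap.add_apply, LinearMap.smul_apply,
    LinearMap.smul_apply, hi, bilin_one_one, smul_eq_mul, smul_zero, add_zero] at h1
  rw [hcd, map_add, map_smul, map_smul, LinearMap.add_apply, LinearMap.smul_apply,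
    LinearMap.smul_apply, bilin_comm 1, hi, smul_zero, zero_add, smul_eq_mul] at h3
  apply Subtype.ext
  rw [hcd, (mul_eq_zero.mp h1).resolve_right h2,
    (mul_eq_zero.mp h3).resolve_right (bilin_self_ne_zero h2 hN), zero_smul, zero_smul, add_zero]
  rfl

section family

variable {ι : Type*} [Fintype ι] {w : ι → C}

theorem exists_isOrtho (h2 : (2 : k) ≠ 0) (hw : ∀ j j', j ≠ j' → L.IsOrtho (w j) (w j'))
    (hwN : ∀ j, norm (k := k) (w j) ≠ 0) (hc : Fintype.card ι < 4) :
    ∃ b : C, (∀ j, L.IsOrtho b (w j)) ∧ norm (k := k) b ≠ 0 := by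
  obtain ⟨i, hi, hN⟩ := L.exists_pure h2
  obtain ⟨b, hb, hbN⟩ := exists_orthogonal_norm_ne_zero (k := k) h2 (L.bilin_family hi hw)
    (L.norm_family hN hwN) (by
      rw [OctonionAlgebra.finrank_eq, Fintype.card_prod, Fintype.card_fin]; omega)
  refine ⟨b, fun j a => ?_, hbN⟩
  obtain ⟨c, d, hcd⟩ := L.exists_eq_smul_add h2 hi hN a
  have h1 := hb (j, 0)
  have h3 := hb (j, 1)
  simp only [Matrix.cons_val_zero, Matrix.cons_val_one, coe_one, one_mul] at h1 h3
  rw [hcd, add_mul, smul_mul_assoc, smul_mul_assoc, one_mul, map_add, map_smul, map_smul, h1, h3,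
    smul_zero, smul_zero, add_zero]

theorem exists_eq_sum (h2 : (2 : k) ≠ 0) (hw : ∀ j j', j ≠ j' → L.IsOrtho (w j) (w j'))
    (hwN : ∀ j, norm (k := k) (w j) ≠ 0) (hc : Fintype.card ι = 4) (x : C) :
    ∃ a : ι → L, x = ∑ j, (a j : C) * w j := by
  classical
  obtain ⟨i, hi, hN⟩ := L.exists_pure h2
  have : Nonempty ι := Fintype.card_pos_iff.mp (by omega)
  have hs := span_eq_top_of_orthogonal (k := k) h2 (L.bilin_family hi hw)
    (L.norm_family hN hwN) (by
      rw [OctonionAlgebra.finrank_eq, Fintype.card_prod, Fintype.card_fin]; omega)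
  have hx : x ∈ Submodule.span k (Set.range fun p : ι × Fin 2 =>
      ((![1, i] p.2 : L) : C) * w p.1) := by rw [hs]; trivial
  induction hx using Submodule.span_induction with
  | mem x h =>
    obtain ⟨p, rfl⟩ := h
    refine ⟨Pi.single p.1 (![1, i] p.2), ?_⟩
    rw [Finset.sum_eq_single p.1]
    · rw [Pi.single_eq_same]
    · intro j _ hj
      rw [Pi.single_eq_of_ne hj]
      exact zero_mul _
    · exact fun h => (h (Finset.mem_univ _)).elim
  | zero => exact ⟨0, by simp⟩
  | add x y _ _ hx hy =>
    obtain ⟨a, ha⟩ := hx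
    obtain ⟨b, hb⟩ := hy
    refine ⟨a + b, ?_⟩
    rw [ha, hb, ← Finset.sum_add_distrib]
    exact Finset.sum_congr rfl fun j _ => (add_mul (a j : C) (b j) (w j)).symm
  | smul c x _ hx =>
    obtain ⟨a, ha⟩ := hx
    refine ⟨c • a, ?_⟩
    rw [ha, Finset.smul_sum]
    exact Finset.sum_congr rfl fun j _ => (smul_mul_assoc c (a j : C) (w j)).symm

end family

theorem exists_mem_perp (h2 : (2 : k) ≠ 0) : ∃ v ∈ L.perp, norm (k := k) v ≠ 0 := by
  obtain ⟨b, hb, hN⟩ := L.exists_isOrtho h2 (w := fun _ : Fin 1 => (1 : C))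
    (fun j j' h => (h (Subsingleton.elim j j')).elim)
    (fun _ => by rw [norm_one]; exact one_ne_zero) (by simp)
  exact ⟨b, isOrtho_one_iff.mp (hb 0), hN⟩

theorem exists_mem_perp_isOrtho (h2 : (2 : k) ≠ 0) {v : C} (hv : v ∈ L.perp) (hvN : norm
    (k := k) v ≠ 0) :
    ∃ b ∈ L.perp, L.IsOrtho b v ∧ norm (k := k) b ≠ 0 := by
  have hv1 : L.IsOrtho v 1 := isOrtho_one_iff.mpr hv
  obtain ⟨b, hb, hN⟩ := L.exists_isOrtho h2 (w := ![1, v])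
    (fun j j' h => by
      fin_cases j <;> fin_cases j'
      · exact (h rfl).elim
      · exact hv1.symm
      · exact hv1
      · exact (h rfl).elim)
    (fun j => by
      fin_cases j
      · change norm (k := k) (1 : C) ≠ 0
        rw [norm_one]; exact one_ne_zero
      · exact hvN) (by simp)
  exact ⟨b, isOrtho_one_iff.mp (hb 0), hb 1, hN⟩

variable {L} in
theorem exists_eq_add_add (h2 : (2 : k) ≠ 0) {v b : C} (hv : v ∈ L.perp) (hb : b ∈ L.perp)
    (hbv : L.IsOrtho b v)
    (hvN : norm (k := k) v ≠ 0) (hbN : norm (k := k) b ≠ 0) (x : C) :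
    ∃ a₀ a₁ a₂ a₃ : L, x = a₀ + a₁ * v + a₂ * b + a₃ * (v * b) := by
  have h1 : L.IsOrtho v 1 := isOrtho_one_iff.mpr hv
  have h3 : L.IsOrtho b 1 := isOrtho_one_iff.mpr hb
  have h4 : L.IsOrtho (v * b) 1 := isOrtho_one_iff.mpr (mul_mem_perp_of_isOrtho hv hbv)
  have h5 := isOrtho_left_mul hv hb
  have h6 := isOrtho_right_mul hv hb hbv
  obtain ⟨a, ha⟩ := L.exists_eq_sum h2 (w := ![1, v, b, v * b])
    (fun j j' h => by
      fin_cases j <;> fin_cases j' <;> first | exact (h rfl).elim | skip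
      · exact h1.symm
      · exact h3.symm
      · exact h4.symm
      · exact h1
      · exact hbv.symm
      · exact h5
      · exact h3
      · exact hbv
      · exact h6
      · exact h4
      · exact h5.symm
      · exact h6.symm)
    (fun j => by
      fin_cases j
      · change norm (k := k) (1 : C) ≠ 0
        rw [norm_one]; exact one_ne_zero
      · exact hvN
      · exact hbN
      · change norm (k := k) (v * b) ≠ 0
        rw [CompositionAlgebra.norm_mul]; exact mul_ne_zero hvN hbN) (by simp) x
  refine ⟨a 0, a 1, a 2, a 3, ?_⟩
  simpa [Fin.sum_univ_four] using ha

variable {L} in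
theorem exists_eq_add_add_of_mem_perp (h2 : (2 : k) ≠ 0) {v b : C} (hv : v ∈ L.perp)
    (hb : b ∈ L.perp)
    (hbv : L.IsOrtho b v) (hvN : norm (k := k) v ≠ 0) (hbN : norm (k := k) b ≠ 0) {x : C}
    (hx : x ∈ L.perp) : ∃ a₁ a₂ a₃ : L, x = a₁ * v + a₂ * b + a₃ * (v * b) := by
  obtain ⟨a₀, a₁, a₂, a₃, h⟩ := exists_eq_add_add h2 hv hb hbv hvN hbN x
  have h0 : (a₀ : C) ∈ L.perp := by
    have : (a₀ : C) = x - (a₁ * v + a₂ * b + a₃ * (v * b)) := by rw [h]; abel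
    rw [this]
    exact L.perp.sub_mem hx (L.perp.add_mem (L.perp.add_mem (L.mul_mem_perp _ hv)
      (L.mul_mem_perp _ hb)) (L.mul_mem_perp _ (mul_mem_perp_of_isOrtho hv hbv)))
  have h00 : a₀ = 0 := L.eq_zero_of_bilin h2 fun c => by rw [bilin_comm]; exact h0 c
  refine ⟨a₁, a₂, a₃, ?_⟩
  rw [h, h00]
  simp

variable {L} in
theorem exists_eq_add_of_isOrtho (h2 : (2 : k) ≠ 0) {v b : C} (hv : v ∈ L.perp) (hb : b ∈ L.perp)
    (hbv : L.IsOrtho b v) (hvN : norm (k := k) v ≠ 0) (hbN : norm (k := k) b ≠ 0) {x : C}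
    (hx : x ∈ L.perp) (hxv : L.IsOrtho x v) : ∃ a₂ a₃ : L, x = a₂ * b + a₃ * (v * b) := by
  obtain ⟨a₁, a₂, a₃, h⟩ := exists_eq_add_add_of_mem_perp h2 hv hb hbv hvN hbN hx
  have h0 : a₁ = 0 := L.eq_zero_of_bilin h2 fun c => by
    have h3 := hxv c
    rw [h, map_add, map_add, LinearMap.add_apply, LinearMap.add_apply, hbv.bilin_mul_mul,
      (isOrtho_left_mul hv hb).symm.bilin_mul_mul, add_zero, add_zero,
      CompositionAlgebra.bilin_mul_mul_right] at h3
    exact (mul_eq_zero.mp h3).resolve_right hvN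
  refine ⟨a₂, a₃, ?_⟩
  rw [h, h0]
  simp

variable {L} in
/-- An automorphism that fixes the generators of `C` is the identity. -/
theorem eq_one_of_fixes (h2 : (2 : k) ≠ 0) {v b : C} (hv : v ∈ L.perp) (hb : b ∈ L.perp)
    (hbv : L.IsOrtho b v)
    (hvN : norm (k := k) v ≠ 0) (hbN : norm (k := k) b ≠ 0) {φ : autGroup k C}
    (hφ : ∀ a : L, (φ : C ≃ₗ[k] C) (a : C) = a) (hφv : (φ : C ≃ₗ[k] C) v = v)
    (hφb : (φ : C ≃ₗ[k] C) b = b) : φ = 1 := by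
  ext x
  obtain ⟨a₀, a₁, a₂, a₃, rfl⟩ := exists_eq_add_add h2 hv hb hbv hvN hbN x
  simp [autGroup_map_mul, hφ, hφv, hφb]

end octonion

end QuadraticSubalgebra

namespace QuadraticSubalgebra

open CompositionAlgebra

/-! ### Inverting t when the coefficient y is zero or invertible -/

section inversion

theorem map_mul_of_fixes {k C : Type*} [Field k] [NonAssocRing C] [Module k C]
    {L : QuadraticSubalgebra k C} {t : autGroup k C} (ht : ∀ a : L, (t : C ≃ₗ[k] C) (a : C) = a)
    (a : L) (x : C) :
    (t : C ≃ₗ[k] C) ((a : C) * x) = (a : C) * (t : C ≃ₗ[k] C) x := by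
  rw [autGroup_map_mul, ht]

variable {k C : Type*} [Field k] [NonAssocRing C] [Module k C]
  [IsScalarTower k C C] [SMulCommClass k C C] [OctonionAlgebra k C]
  {L : QuadraticSubalgebra k C}

theorem conj_smul (c : k) (a : L) : L.conj (c • a) = c • L.conj a := by
  apply Subtype.ext
  change bilin k (c • (a : C)) 1 • (1 : C) - c • (a : C) = c • (bilin k (a : C) 1 • (1 : C) - a)
  rw [map_smul, LinearMap.smul_apply, smul_eq_mul]
  module

theorem conj_sub (a b : L) : L.conj (a - b) = L.conj a - L.conj b := by
  apply Subtype.ext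
  change bilin k ((a : C) - b) 1 • (1 : C) - ((a : C) - b) =
    (bilin k (a : C) 1 • (1 : C) - a) - (bilin k (b : C) 1 • (1 : C) - b)
  rw [map_sub, LinearMap.sub_apply]
  module

theorem conj_one : L.conj 1 = 1 := by
  apply Subtype.ext
  rw [coe_conj, coe_one, bilin_one_one]
  module

theorem IsOrtho.add {x x' y : C} (h : L.IsOrtho x y) (h' : L.IsOrtho x' y) :
    L.IsOrtho (x + x') y := by
  intro a
  rw [map_add, LinearMap.add_apply, h a, h' a, add_zero]

theorem bilin_mul_eq (a : L) (x y : C) :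
    bilin k x ((a : C) * y) = bilin k ((L.conj a : C) * x) y := by
  rw [bilin_comm, bilin_mul_conj, bilin_comm]

variable {t : autGroup k C}

theorem map_mem_perp (ht : ∀ a : L, (t : C ≃ₗ[k] C) (a : C) = a) {x : C} (hx : x ∈ L.perp) :
    (t : C ≃ₗ[k] C) x ∈ L.perp := by
  intro a
  have h := bilin_apply_apply t (a : C) x
  rw [ht] at h
  rw [h, hx a]

theorem IsOrtho.map (ht : ∀ a : L, (t : C ≃ₗ[k] C) (a : C) = a) {x y : C} (h : L.IsOrtho x y) :
    L.IsOrtho ((t : C ≃ₗ[k] C) x) ((t : C ≃ₗ[k] C) y) := by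
  intro a
  rw [← map_mul_of_fixes ht, bilin_apply_apply, h]

theorem conj_mul_self_of_eigenvector {v : C} {a : L} (hvN : norm (k := k) v ≠ 0)
    (htv : (t : C ≃ₗ[k] C) v = a * v) : L.conj a * a = 1 := by
  have h := norm_apply (k := k) t v
  rw [htv, CompositionAlgebra.norm_mul] at h
  rw [mul_comm, mul_conj, mul_right_cancel₀ hvN (h.trans (one_mul _).symm), one_smul]

/-- The image of x is orthogonal to t v = a v, and a is a unit of L with inverse ā. -/
theorem IsOrtho.map_of_eigenvector (ht : ∀ a : L, (t : C ≃ₗ[k] C) (a : C) = a) {v x : C} {a : L}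
    (hvN : norm (k := k) v ≠ 0)
    (htv : (t : C ≃ₗ[k] C) v = a * v) (h : L.IsOrtho x v) :
    L.IsOrtho ((t : C ≃ₗ[k] C) x) v := by
  have h1 := (h.map ht).mul_mul 1 (L.conj a)
  rwa [htv, ← L.mul_mul, ← coe_mul, conj_mul_self_of_eigenvector hvN htv, coe_one, one_mul,
    one_mul] at h1

/-- The image of `v b` under an automorphism for which `v` is an eigenvector. -/
theorem mul_apply_of_eigenvector {v b : C} (hv : v ∈ L.perp) (hb : b ∈ L.perp)
    (hbv : L.IsOrtho b v) {a x y : L} {c : C} (hc : c = x * b + y * (v * b)) :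
    (a * v) * c = (L.conj x * L.conj a : L) * (v * b) +
      -norm (k := k) v • ((L.conj y * L.conj a : L) * b) := by
  have hav := L.mul_mem_perp a hv
  rw [hc, mul_add, L.perp_mul_mul hav, L.perp_mul_mul hav, mul_mul_of_isOrtho hv hb hbv,
    mul_mul_of_isOrtho hv (mul_mem_perp_of_isOrtho hv hbv) (isOrtho_left_mul hv hb).symm,
    mul_mul_self_of_pure (k := k) (L.bilin_one_of_mem_perp hv), mul_smul_comm, mul_smul_comm,
    coe_mul, coe_mul, L.mul_mul, L.mul_mul]

theorem norm_add_norm_of_apply {v b : C} (hv : v ∈ L.perp) (hb : b ∈ L.perp)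
    (hbv : L.IsOrtho b v) (hbN : norm (k := k) b ≠ 0) {x y : L}
    (htb : (t : C ≃ₗ[k] C) b = x * b + y * (v * b)) :
    norm (k := k) (x : C) + norm (k := k) (y : C) * norm (k := k) v = 1 := by
  have h := norm_apply (k := k) t b
  rw [htb, norm_add, (isOrtho_right_mul hv hb hbv).bilin_mul_mul, add_zero,
    CompositionAlgebra.norm_mul, CompositionAlgebra.norm_mul, CompositionAlgebra.norm_mul] at h
  apply mul_right_cancel₀ hbN
  linear_combination h

/-- The traceless part of L is orthogonal to 1, v, b and vb, so ρ negates it. -/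
theorem apply_eq_conj (h2 : (2 : k) ≠ 0) {v b : C} (hv : v ∈ L.perp) (hb : b ∈ L.perp)
    (hbv : L.IsOrtho b v) {ρ : autGroup k C}
    (hρ : ∀ j : C, bilin k j 1 = 0 → bilin k j v = 0 → bilin k j b = 0 → bilin k j (v * b) = 0 →
        (ρ : C ≃ₗ[k] C) j = -j) (a : L) : (ρ : C ≃ₗ[k] C) (a : C) = L.conj a := by
  let j : L := a - (bilin k (a : C) 1 / 2) • (1 : L)
  have hj : (j : C) = a - (bilin k (a : C) 1 / 2) • (1 : C) := rfl
  have h1 : bilin k (j : C) 1 = 0 := by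
    rw [hj, map_sub, map_smul, LinearMap.sub_apply, LinearMap.smul_apply, bilin_one_one,
      smul_eq_mul, div_mul_cancel₀ _ h2, sub_self]
  have h3 := hρ j h1 (hv j) (hb j) (mul_mem_perp_of_isOrtho hv hbv j)
  have h4 : (a : C) = j + (bilin k (a : C) 1 / 2) • (1 : C) := by rw [hj]; abel
  have h5 : bilin k (a : C) 1 • (1 : C) =
      (bilin k (a : C) 1 / 2) • (1 : C) + (bilin k (a : C) 1 / 2) • (1 : C) := by
    have : NeZero (2 : k) := ⟨h2⟩
    rw [← add_smul, add_halves]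
  have h6 : (L.conj a : C) = -j + (bilin k (a : C) 1 / 2) • (1 : C) := by
    rw [coe_conj, h5, hj]; abel
  rw [h6, h4, map_add, h3, map_smul, autGroup_map_one, ← h4]

variable [Algebra.Etale k L]

/-- Put s = tρ, which is conjugate linear over L. On v, s² is multiplication by ā a = 1. In s² b the
coefficient of vb is x̄(y + ȳ ā) = 0, and that of b becomes N(x) + N(y)N(v) = 1, because t preserves
N(b). -/
theorem exists_inverting_involution_of_eq_neg (h2 : (2 : k) ≠ 0)
    (ht : ∀ a : L, (t : C ≃ₗ[k] C) (a : C) = a) {v b : C} (hv : v ∈ L.perp) (hb : b ∈ L.perp)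
    (hbv : L.IsOrtho b v) (hvN : norm (k := k) v ≠ 0) (hbN : norm (k := k) b ≠ 0) {a x y : L}
    (htv : (t : C ≃ₗ[k] C) v = a * v) (htb : (t : C ≃ₗ[k] C) b = x * b + y * (v * b))
    (hy : y = -(L.conj y * L.conj a)) :
    ∃ ρ : autGroup k C, ρ ^ 2 = 1 ∧ (t * ρ) ^ 2 = 1 := by
  obtain ⟨ρ, hρ2, hρv, hρb, hρ⟩ := exists_involution (L.bilin_one_of_mem_perp hv)
    (L.bilin_one_of_mem_perp hb) hbv.symm.bilin_eq hvN hbN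
  have hρL := apply_eq_conj h2 hv hb hbv hρ
  have hs : ∀ z, ((t * ρ : autGroup k C) : C ≃ₗ[k] C) z =
      (t : C ≃ₗ[k] C) ((ρ : C ≃ₗ[k] C) z) := fun _ => rfl
  have hsL : ∀ c : L, ((t * ρ : autGroup k C) : C ≃ₗ[k] C) (c : C) = L.conj c := by
    intro c
    rw [hs, hρL, ht]
  have hsv : ((t * ρ : autGroup k C) : C ≃ₗ[k] C) v = a * v := by rw [hs, hρv, htv]
  have hsb : ((t * ρ : autGroup k C) : C ≃ₗ[k] C) b = x * b + y * (v * b) := by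
    rw [hs, hρb, htb]
  have hss : ∀ z, (((t * ρ) ^ 2 : autGroup k C) : C ≃ₗ[k] C) z =
      ((t * ρ : autGroup k C) : C ≃ₗ[k] C) (((t * ρ : autGroup k C) : C ≃ₗ[k] C) z) := by
    intro z
    rw [pow_two]
    rfl
  refine ⟨ρ, hρ2, eq_one_of_fixes h2 hv hb hbv hvN hbN (fun c => ?_) ?_ ?_⟩
  · rw [hss, hsL, hsL, conj_conj]
  · rw [hss, hsv, autGroup_map_mul, hsL, hsv, ← L.mul_mul, ← coe_mul,
      conj_mul_self_of_eigenvector hvN htv, coe_one, one_mul]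
  · have h1 := norm_add_norm_of_apply hv hb hbv hbN htb
    rw [hss, hsb, map_add, autGroup_map_mul, autGroup_map_mul, autGroup_map_mul, hsL, hsL, hsv, hsb,
      mul_apply_of_eigenvector (k := k) hv hb hbv rfl, mul_add, mul_add, mul_smul_comm,
      ← L.mul_mul, ← L.mul_mul, ← L.mul_mul, ← L.mul_mul, ← coe_mul, ← coe_mul, ← coe_mul,
      ← coe_mul]
    have e1 : L.conj y * (L.conj x * L.conj a) = -(L.conj x * y) := by
      linear_combination L.conj x * hy
    have e2 : L.conj y * (L.conj y * L.conj a) = -(norm (k := k) (y : C) • (1 : L)) := by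
      rw [← mul_conj]
      linear_combination L.conj y * hy
    have e3 : L.conj x * x = norm (k := k) (x : C) • (1 : L) := by rw [mul_comm, mul_conj]
    rw [e1, e2, e3]
    change norm (k := k) (x : C) • (1 : C) * b + ((L.conj x * y : L) : C) * (v * b) +
      (-((L.conj x * y : L) : C) * (v * b) + -norm (k := k) v •
        (-(norm (k := k) (y : C) • (1 : C)) * b)) = b
    simp only [smul_mul_assoc, one_mul, neg_mul]
    have h3 := congrArg (fun c : k => c • b) h1
    simp only [add_smul, mul_smul, one_smul] at h3
    linear_combination (norm := module) h3

/-- A form of Hilbert's theorem 90 for the quadratic algebra `L`. -/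
theorem exists_conj_eq_neg_mul (h2 : (2 : k) ≠ 0) {a : L} (ha : L.conj a * a = 1) :
    ∃ z : L, norm (k := k) (z : C) ≠ 0 ∧ L.conj z = -(a * z) := by
  have hN : norm (k := k) (a : C) = 1 := by
    have h := congrArg (fun c : L => norm (k := k) (c : C)) ha
    simp only [coe_mul, CompositionAlgebra.norm_mul, norm_conj, coe_one, norm_one] at h
    rcases mul_self_eq_one_iff.mp h with h | h
    · exact h
    · exfalso
      have h4 := ha
      rw [mul_comm, mul_conj, h] at h4
      have h5 := congrArg (fun c : L => bilin k (c : C) 1) h4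
      change bilin k ((-1 : k) • (1 : C)) 1 = bilin k (1 : C) 1 at h5
      rw [map_smul, LinearMap.smul_apply, bilin_one_one, smul_eq_mul] at h5
      have h6 : (2 : k) * 2 = 0 := by linear_combination -h5
      exact h2 (mul_self_eq_zero.mp h6)
  have hsub : norm (k := k) ((1 - L.conj a : L) : C) = 2 - bilin k (a : C) 1 := by
    have h := norm_add (k := k) (1 : C) (-(L.conj a : C))
    rw [QuadraticMap.map_neg, norm_conj, norm_one, hN, map_neg, bilin_comm, coe_conj, map_sub,
      map_smul, LinearMap.sub_apply, LinearMap.smul_apply, bilin_one_one, smul_eq_mul,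
      ← coe_conj] at h
    rw [sub_eq_add_neg]
    refine h.trans ?_
    ring
  -- The natural solution z = 1 - ā has norm 2 - T(a), where T is the trace. If this vanishes, z =
  -- i(1 + ā) with i of trace zero works, since 1 + ā has norm 2 + T(a) = 4.
  by_cases hT : 2 - bilin k (a : C) 1 = 0
  · obtain ⟨i, hi, hiN⟩ := L.exists_pure h2
    have hadd : norm (k := k) ((1 + L.conj a : L) : C) = 2 + bilin k (a : C) 1 := by
      have h := norm_add (k := k) (1 : C) (L.conj a : C)
      rw [norm_conj, norm_one, hN, bilin_comm, coe_conj, map_sub,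
        map_smul, LinearMap.sub_apply, LinearMap.smul_apply, bilin_one_one, smul_eq_mul,
        ← coe_conj] at h
      refine h.trans ?_
      ring
    refine ⟨i * (1 + L.conj a), ?_, ?_⟩
    · rw [coe_mul, CompositionAlgebra.norm_mul, hadd]
      refine mul_ne_zero hiN fun h => h2 (mul_self_eq_zero.mp ?_)
      linear_combination h + hT
    · have h1 : L.conj i = -i := by
        apply Subtype.ext
        rw [coe_conj, hi, zero_smul, zero_sub]
        rfl
      have h3 : L.conj (1 + L.conj a) = 1 + a := by
        rw [← sub_neg_eq_add, conj_sub, conj_one, ← neg_one_smul k (L.conj a), conj_smul, conj_conj,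
          neg_one_smul, sub_neg_eq_add]
      rw [conj_mul, h1, h3]
      linear_combination i * ha
  · refine ⟨1 - L.conj a, by rwa [hsub], ?_⟩
    rw [conj_sub, conj_one, conj_conj]
    linear_combination -ha

/-- Replace v by v' = zȳv. Then v'b = z̄y(vb), so the coefficient y becomes z̄⁻¹ = N(z)⁻¹z while a
and x are unchanged. The condition of `exists_inverting_involution_of_eq_neg` then reads z̄ = -az,
which Hilbert 90 solves. -/
theorem exists_inverting_involution_of_apply (h2 : (2 : k) ≠ 0)
    (ht : ∀ a : L, (t : C ≃ₗ[k] C) (a : C) = a) {v b : C} (hv : v ∈ L.perp) (hb : b ∈ L.perp)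
    (hbv : L.IsOrtho b v) (hvN : norm (k := k) v ≠ 0) (hbN : norm (k := k) b ≠ 0) {a x y : L}
    (htv : (t : C ≃ₗ[k] C) v = a * v) (htb : (t : C ≃ₗ[k] C) b = x * b + y * (v * b))
    (hy : y = 0 ∨ norm (k := k) (y : C) ≠ 0) :
    ∃ ρ : autGroup k C, ρ ^ 2 = 1 ∧ (t * ρ) ^ 2 = 1 := by
  have ha := conj_mul_self_of_eigenvector hvN htv
  rcases hy with hy | hy
  · refine exists_inverting_involution_of_eq_neg h2 ht hv hb hbv hvN hbN htv htb ?_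
    have h0 : L.conj (0 : L) = 0 := by
      have := conj_smul (0 : k) (0 : L)
      rwa [zero_smul, zero_smul] at this
    rw [hy, h0, zero_mul, neg_zero]
  obtain ⟨z, hzN, hz⟩ := exists_conj_eq_neg_mul h2 ha
  have hbv' := hbv.mul_mul 1 (z * L.conj y)
  rw [coe_one, one_mul] at hbv'
  have hzz : L.conj z * z = norm (k := k) (z : C) • (1 : L) := by rw [mul_comm, mul_conj]
  refine exists_inverting_involution_of_eq_neg h2 ht (L.mul_mem_perp (z * L.conj y) hv) hb
    hbv' ?_ hbN (a := a) (x := x) (y := (norm (k := k) (z : C))⁻¹ • z) ?_ ?_ ?_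
  · rw [CompositionAlgebra.norm_mul, coe_mul, CompositionAlgebra.norm_mul, norm_conj]
    exact mul_ne_zero (mul_ne_zero hzN hy) hvN
  · rw [map_mul_of_fixes ht, htv, ← L.mul_mul, ← L.mul_mul, ← coe_mul, ← coe_mul, mul_comm a]
  · rw [htb, mul_mul_of_isOrtho hv hb hbv, ← L.mul_mul, ← coe_mul]
    congr 3
    rw [conj_mul, conj_conj, smul_mul_assoc, ← mul_assoc, mul_comm z, hzz, smul_mul_assoc, one_mul,
      smul_smul, inv_mul_cancel₀ hzN, one_smul]
  · rw [conj_smul, smul_mul_assoc, ← smul_neg]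
    congr 1
    rw [hz]
    linear_combination -z * ha

end inversion

end QuadraticSubalgebra

namespace QuadraticSubalgebra

open CompositionAlgebra

/-! ### Split L: making the coefficient y invertible -/

section idempotent

variable {k C : Type*} [Field k] [NonAssocRing C] [Module k C]
  [IsScalarTower k C C] [SMulCommClass k C C] [OctonionAlgebra k C]
  {L : QuadraticSubalgebra k C}

theorem ne_smul_one_of_idempotent {k C : Type*} [Field k] [NonAssocRing C] [Module k C]
    [IsScalarTower k C C] [SMulCommClass k C C] {L : QuadraticSubalgebra k C} {e : L}
    (he : e * e = e) (he0 : e ≠ 0) (he1 : e ≠ 1) (c : k) :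
    (e : C) ≠ c • (1 : C) := by
  intro hc
  have hc' : e = c • (1 : L) := Subtype.ext hc
  by_cases h0 : c = 0
  · exact he0 (by rw [hc', h0, zero_smul])
  · apply he1
    rw [hc', smul_mul_smul_comm, mul_one, mul_smul] at he
    rw [hc']
    exact smul_right_injective L h0 he

/-- Comparing e² = T(e)e - N(e) with e² = e forces T(e) = 1, as e is not a scalar. -/
theorem conj_of_idempotent {e : L} (he : e * e = e) (he0 : e ≠ 0) (he1 : e ≠ 1) :
    L.conj e = 1 - e := by
  have h := mul_self (k := k) (e : C)
  rw [← coe_mul, he] at h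
  have hT : bilin k (e : C) 1 - 1 = 0 := by
    by_contra hT
    refine ne_smul_one_of_idempotent he he0 he1
      ((bilin k (e : C) 1 - 1)⁻¹ * norm (k := k) (e : C)) ?_
    apply smul_right_injective C hT
    dsimp only
    rw [smul_smul, ← mul_assoc, mul_inv_cancel₀ hT, one_mul]
    linear_combination (norm := module) -h
  apply Subtype.ext
  rw [coe_conj, sub_eq_zero.mp hT, one_smul]
  rfl

theorem exists_eq_smul_idempotent {k C : Type*} [Field k] [NonAssocRing C] [Module k C]
    [IsScalarTower k C C] [SMulCommClass k C C] {L : QuadraticSubalgebra k C} {e : L}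
    (he : e * e = e) (he0 : e ≠ 0) (he1 : e ≠ 1) (a : L) :
    ∃ α β : k, a = α • e + β • (1 - e) := by
  rcases L.exists_eq e a with ⟨c, hc⟩ | ⟨c, d, h⟩
  · exact (ne_smul_one_of_idempotent he he0 he1 c hc).elim
  · refine ⟨c + d, c, ?_⟩
    have h' : a = c • (1 : L) + d • e := Subtype.ext h
    rw [h']
    module

/-- The conjugation exchanges e and 1 - e, so αe + β(1 - e) has norm αβ. -/
theorem norm_ne_zero_of_idempotent {e : L} (he : e * e = e) (he0 : e ≠ 0) (he1 : e ≠ 1) {a : L}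
    (h : a * e ≠ 0) (h' : a * (1 - e) ≠ 0) : norm (k := k) (a : C) ≠ 0 := by
  obtain ⟨α, β, rfl⟩ := exists_eq_smul_idempotent he he0 he1 a
  have hce := conj_of_idempotent he he0 he1
  have he' : (1 - e) * e = 0 := by rw [sub_mul, one_mul, he, sub_self]
  have h1 : (α • e + β • (1 - e)) * e = α • e := by
    rw [add_mul, smul_mul_assoc, smul_mul_assoc, he, he', smul_zero, add_zero]
  have h3 : (α • e + β • (1 - e)) * (1 - e) = β • (1 - e) := by
    rw [mul_sub, h1, mul_one]; abel
  have hα : α ≠ 0 := fun h0 => h (by rw [h1, h0, zero_smul])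
  have hβ : β ≠ 0 := fun h0 => h' (by rw [h3, h0, zero_smul])
  intro hN
  have h4 := mul_conj L (α • e + β • (1 - e))
  have h5 : L.conj (α • e + β • (1 - e)) = α • (1 - e) + β • e := by
    rw [← sub_neg_eq_add, conj_sub, ← neg_smul, conj_smul, conj_smul, conj_sub, conj_one, hce,
      sub_sub_cancel]
    module
  rw [hN, zero_smul, h5] at h4
  have h6 := congrArg (· * e) h4
  simp only [zero_mul] at h6
  rw [mul_right_comm, h1, smul_mul_assoc, mul_add, mul_smul_comm, mul_smul_comm, he,
    mul_comm e, he', smul_zero, zero_add, smul_smul] at h6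
  rcases smul_eq_zero.mp h6 with h6 | h6
  · exact mul_ne_zero hα hβ h6
  · exact he0 h6

theorem norm_eq_zero_of_idempotent {e : L} (he : e * e = e) (he0 : e ≠ 0) (he1 : e ≠ 1) :
    norm (k := k) (e : C) = 0 := by
  have h := mul_conj L e
  rw [conj_of_idempotent he he0 he1, mul_sub, mul_one, he, sub_self] at h
  exact (smul_eq_zero.mp h.symm).resolve_right fun h1 => he0 (by rw [← mul_one e, h1, mul_zero])

variable [Algebra.Etale k L] {t : autGroup k C}

/-- Multiplication by v exchanges the Peirce components, so w and u = t(vw) are isotropic vectors in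
opposite components, and b = w + u has norm N(w, u) ≠ 0. For this b both components of y are
nonzero. -/
theorem exists_inverting_involution_of_bilin_ne_zero (h2 : (2 : k) ≠ 0)
    (ht : ∀ a : L, (t : C ≃ₗ[k] C) (a : C) = a) {e : L} (he : e * e = e) (he0 : e ≠ 0)
    (he1 : e ≠ 1) {v w : C} (hv : v ∈ L.perp) (hw : w ∈ L.perp) (hwv : L.IsOrtho w v)
    (hvN : norm (k := k) v ≠ 0) {a : L} (htv : (t : C ≃ₗ[k] C) v = a * v)
    (hew : (e : C) * w = w) (hwt : bilin k w ((t : C ≃ₗ[k] C) (v * w)) ≠ 0) :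
    ∃ ρ : autGroup k C, ρ ^ 2 = 1 ∧ (t * ρ) ^ 2 = 1 := by
  set u : C := (t : C ≃ₗ[k] C) (v * w) with hu
  have hvw : v * w ∈ L.perp := mul_mem_perp_of_isOrtho hv hwv
  have hup : u ∈ L.perp := map_mem_perp ht hvw
  have huv : L.IsOrtho u v := (isOrtho_left_mul hv hw).symm.map_of_eigenvector ht hvN htv
  have hb : w + u ∈ L.perp := L.perp.add_mem hw hup
  have hbv : L.IsOrtho (w + u) v := hwv.add huv
  have hwN : norm (k := k) w = 0 := by
    rw [← hew, CompositionAlgebra.norm_mul, norm_eq_zero_of_idempotent he he0 he1, zero_mul]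
  have huN : norm (k := k) u = 0 := by
    rw [hu, norm_apply, CompositionAlgebra.norm_mul, hwN, mul_zero]
  have hbN : norm (k := k) (w + u) ≠ 0 := by
    rw [norm_add, hwN, huN, zero_add, zero_add]; exact hwt
  have hvwe : (e : C) * (v * w) = 0 := by
    have h := L.perp_mul_mul hv e w
    rw [hew, conj_of_idempotent he he0 he1] at h
    rw [h, ← L.mul_mul, ← coe_mul, mul_sub, mul_one, he, sub_self]
    exact zero_mul _
  have heu : (e : C) * u = 0 := by rw [hu, ← map_mul_of_fixes ht, hvwe, map_zero]
  have hetw : (e : C) * (t : C ≃ₗ[k] C) w = (t : C ≃ₗ[k] C) w := by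
    rw [← map_mul_of_fixes ht, hew]
  have hetu : (e : C) * (t : C ≃ₗ[k] C) u = 0 := by rw [← map_mul_of_fixes ht, heu, map_zero]
  obtain ⟨x, y, hxy⟩ := exists_eq_add_of_isOrtho h2 hv hb hbv hvN hbN (map_mem_perp ht hb)
    (hbv.map_of_eigenvector ht hvN htv)
  refine exists_inverting_involution_of_apply h2 ht hv hb hbv hvN hbN htv hxy (Or.inr ?_)
  have he' := congrArg ((e : C) * ·) hxy
  simp only [map_add, mul_add, hetw, hetu, add_zero] at he'
  simp only [← L.mul_mul, ← coe_mul, mul_comm e] at he'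
  have hxw : ((x * e : L) : C) * w = x * w := by rw [coe_mul, L.mul_mul, hew]
  have hxu : ((x * e : L) : C) * u = 0 := by rw [coe_mul, L.mul_mul, heu, mul_zero]
  refine norm_ne_zero_of_idempotent he he0 he1 (fun hy => ?_) fun hy => ?_
  -- If ye = 0, the e-component of t b gives t w = αw. Then α N(w, u) = N(t w, t(vw)) = N(w, vw) =
  -- 0, so α = 0 and w = 0.
  · obtain ⟨α, β, hx⟩ := exists_eq_smul_idempotent he he0 he1 x
    have hxe : x * e = α • e := by
      rw [hx, add_mul, smul_mul_assoc, smul_mul_assoc, sub_mul, one_mul, he, sub_self, smul_zero,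
        add_zero]
    rw [hxu, hy, hxe, add_zero] at he'
    have h1 : (t : C ≃ₗ[k] C) w = α • w := by
      have h0 : ((0 : L) : C) = 0 := rfl
      rw [he', h0, zero_mul, zero_mul, add_zero, add_zero]
      exact (smul_mul_assoc α (e : C) w).trans (by rw [hew])
    have h3 := bilin_apply_apply t w (v * w)
    rw [h1, bilin_right_mul (L.bilin_one_of_mem_perp hv), map_smul, LinearMap.smul_apply,
      smul_eq_mul] at h3
    rw [(mul_eq_zero.mp h3).resolve_right hwt, zero_smul] at h1
    have h4 : w = 0 := (t : C ≃ₗ[k] C).injective (by rw [h1, map_zero])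
    exact hwt (by rw [h4, map_zero, LinearMap.zero_apply])
  -- If y(1 - e) = 0, the other component gives t u = xu, that is u = x(vw), which is orthogonal to
  -- w.
  · have h1 : (t : C ≃ₗ[k] C) u = x * u := by
      have hye : y = y * e := by
        rw [mul_sub, mul_one] at hy
        exact sub_eq_zero.mp hy
      have h4 := hxy
      rw [map_add, hye, mul_add (x : C)] at h4
      rw [hxu, hxw, add_zero] at he'
      rw [he', mul_add, mul_add] at h4
      linear_combination (norm := module) h4
    have h3 : u = x * (v * w) := by
      apply (t : C ≃ₗ[k] C).injective
      rw [map_mul_of_fixes ht, h1]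
    apply hwt
    rw [h3, isOrtho_right_mul hv hw hwv]

/-- The vector w = eb meets the requirement: N(w, t(vw)) = -N(v) α N(b), where yae = αe, and α ≠ 0
because a is a unit. -/
theorem exists_inverting_involution_of_mul_ne_zero (h2 : (2 : k) ≠ 0)
    (ht : ∀ a : L, (t : C ≃ₗ[k] C) (a : C) = a) {e : L} (he : e * e = e) (he0 : e ≠ 0)
    (he1 : e ≠ 1) {v b : C} (hv : v ∈ L.perp) (hb : b ∈ L.perp) (hbv : L.IsOrtho b v)
    (hvN : norm (k := k) v ≠ 0) (hbN : norm (k := k) b ≠ 0) {a x y : L}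
    (htv : (t : C ≃ₗ[k] C) v = a * v)
    (htb : (t : C ≃ₗ[k] C) b = x * b + y * (v * b)) (hy : y * e ≠ 0) :
    ∃ ρ : autGroup k C, ρ ^ 2 = 1 ∧ (t * ρ) ^ 2 = 1 := by
  have hbv' := hbv.mul_mul e 1
  rw [coe_one, one_mul] at hbv'
  refine exists_inverting_involution_of_bilin_ne_zero h2 ht he he0 he1 hv
    (L.mul_mem_perp e hb) hbv' hvN htv (by rw [← L.mul_mul, ← coe_mul, he]) ?_
  have hce := conj_of_idempotent he he0 he1
  have hcce : L.conj (L.conj e) = e := conj_conj L e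
  obtain ⟨α, β, hay⟩ := exists_eq_smul_idempotent he he0 he1 (y * a)
  have haye : y * a * e = α • e := by
    rw [hay, add_mul, smul_mul_assoc, smul_mul_assoc, sub_mul, one_mul, he, sub_self, smul_zero,
      add_zero]
  have hα : α ≠ 0 := by
    rintro rfl
    apply hy
    rw [zero_smul] at haye
    have ha := conj_mul_self_of_eigenvector hvN htv
    linear_combination L.conj a * haye - y * e * ha
  have heT : bilin k (e : C) 1 = 1 := by
    have h := congrArg (Subtype.val : L → C) hce
    rw [coe_conj] at h
    change _ = (1 : C) - e at h
    have h1 : bilin k (e : C) 1 • (1 : C) = (1 : k) • (1 : C) := by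
      rw [one_smul]
      exact sub_left_injective h
    have : (1 : C) ≠ 0 := by
      intro h0
      have h3 := norm_one k C
      rw [h0, QuadraticMap.map_zero] at h3
      exact zero_ne_one h3
    exact smul_left_injective k this h1
  rw [L.perp_mul_mul hv, map_mul_of_fixes ht, bilin_mul_eq, hcce, ← L.mul_mul, ← coe_mul, he,
    autGroup_map_mul, htv, mul_apply_of_eigenvector (k := k) hv hb hbv htb, map_add,
    (isOrtho_right_mul hv hb hbv).bilin_mul_mul, zero_add, map_smul,
    CompositionAlgebra.bilin_mul_mul_right]
  have h5 : bilin k (e : C) ((L.conj y * L.conj a : L) : C) = α := by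
    have h := bilin_mul_eq (L.conj y * L.conj a) (e : C) 1
    rw [mul_one] at h
    rw [h, conj_mul, conj_conj, conj_conj, ← coe_mul, haye]
    change bilin k (α • (e : C)) 1 = α
    rw [map_smul, LinearMap.smul_apply, heT, smul_eq_mul, mul_one]
  rw [h5, smul_eq_mul]
  exact mul_ne_zero (neg_ne_zero.mpr hvN) (mul_ne_zero hα hbN)

/-- An automorphism fixing `L` that has an anisotropic eigenvector in `L^⊥` is inverted by an
involution. -/
theorem exists_inverting_involution_of_eigenvector (h2 : (2 : k) ≠ 0)
    (hL : IsField L ∨ ∃ e : L, e * e = e ∧ e ≠ 0 ∧ e ≠ 1)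
    (ht : ∀ a : L, (t : C ≃ₗ[k] C) (a : C) = a) {v : C} (hv : v ∈ L.perp)
    (hvN : norm (k := k) v ≠ 0) {a : L} (htv : (t : C ≃ₗ[k] C) v = a * v) :
    ∃ ρ : autGroup k C, ρ ^ 2 = 1 ∧ (t * ρ) ^ 2 = 1 := by
  obtain ⟨b, hb, hbv, hbN⟩ := L.exists_mem_perp_isOrtho h2 hv hvN
  obtain ⟨x, y, hxy⟩ := exists_eq_add_of_isOrtho h2 hv hb hbv hvN hbN (map_mem_perp ht hb)
    (hbv.map_of_eigenvector ht hvN htv)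
  rcases hL with hL | ⟨e, he, he0, he1⟩
  · refine exists_inverting_involution_of_apply h2 ht hv hb hbv hvN hbN htv hxy ?_
    by_cases hy : y = 0
    · exact Or.inl hy
    · refine Or.inr fun hN => hy ?_
      have := hL.isDomain
      have h := mul_conj L y
      rw [hN, zero_smul] at h
      have h0 := (mul_eq_zero.mp h).resolve_left hy
      rw [← conj_conj L y, h0, ← zero_smul k (0 : L), conj_smul, zero_smul, zero_smul]
  -- Either some component of y is nonzero, where e and 1 - e play symmetric roles, or y = 0.
  · by_cases hye : y * e = 0
    · by_cases hye' : y * (1 - e) = 0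
      · refine exists_inverting_involution_of_apply h2 ht hv hb hbv hvN hbN htv hxy (Or.inl ?_)
        linear_combination hye + hye'
      · refine exists_inverting_involution_of_mul_ne_zero h2 ht (e := 1 - e) ?_ ?_ ?_ hv hb hbv
          hvN hbN htv hxy hye'
        · linear_combination he
        · exact sub_ne_zero.mpr he1.symm
        · exact fun h => he0 (by linear_combination -h)
    · exact exists_inverting_involution_of_mul_ne_zero h2 ht he he0 he1 hv hb hbv hvN hbN htv hxy
        hye

end idempotent

end QuadraticSubalgebra

/-! ### Eigenvectors from a reducible characteristic polynomial -/

namespace LinearMap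

/-- A monic polynomial of degree 2 or 3 without roots is irreducible, and degree 1 is irreducible
anyway. Hence a nonzero module of rank at most 3 suffices, and the exact rank is not needed. -/
theorem exists_apply_eq_smul_of_not_irreducible_charpoly {R M : Type*} [CommRing R] [IsDomain R]
    [AddCommGroup M] [Module R M] [Module.Free R M] [Module.Finite R M] (f : M →ₗ[R] M)
    [Nontrivial M] (h3 : Module.finrank R M ≤ 3) (hf : ¬ Irreducible f.charpoly) :
    ∃ (μ : R) (x : M), x ≠ 0 ∧ f x = μ • x := by
  have h0 : 0 < Module.finrank R M := Module.finrank_pos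
  rw [← f.charpoly_natDegree] at h0 h3
  have hm := f.charpoly_monic
  have h2 : 2 ≤ f.charpoly.natDegree := by
    by_contra h
    refine hf (Polynomial.Monic.irreducible_of_degree_eq_one ?_ hm)
    rw [Polynomial.degree_eq_natDegree hm.ne_zero, show f.charpoly.natDegree = 1 by omega]
    rfl
  rw [hm.irreducible_iff_roots_eq_zero_of_degree_le_three h2 h3] at hf
  obtain ⟨μ, hμ⟩ := Multiset.exists_mem_of_ne_zero hf
  obtain ⟨x, hx⟩ := ((Module.End.hasEigenvalue_iff_isRoot_charpoly f μ).mpr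
    (Polynomial.isRoot_of_mem_roots hμ)).exists_hasEigenvector
  exact ⟨μ, x, hx.2, hx.apply_eq_smul⟩

end LinearMap

namespace QuadraticSubalgebra

open CompositionAlgebra

/-! ### Anisotropic eigenvectors from semisimplicity -/

section eigenvector

variable {k C : Type*} [Field k] [NonAssocRing C] [Module k C]
  [IsScalarTower k C C] [SMulCommClass k C C] [OctonionAlgebra k C]
  {L : QuadraticSubalgebra k C} {t : autGroup k C}

theorem eq_zero_of_mul_eq_zero {a : L} (ha : norm (k := k) (a : C) ≠ 0) {x : C}
    (h : (a : C) * x = 0) : x = 0 := by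
  have h1 := congrArg ((L.conj a : C) * ·) h
  simp only [mul_zero] at h1
  rw [← L.mul_mul, ← coe_mul, mul_comm, mul_conj] at h1
  change (norm (k := k) (a : C) • (1 : C)) * x = 0 at h1
  rw [smul_mul_assoc, one_mul] at h1
  exact (smul_eq_zero.mp h1).resolve_left ha

theorem mul_mul_eq_smul (a : L) (x : C) :
    (a : C) * (a * x) = bilin k (a : C) 1 • ((a : C) * x) - norm (k := k) (a : C) • x :=
  mul_mul_self (a : C) x

theorem sub_mul_of_mem_peirce {k C : Type*} [Field k] [NonAssocRing C] [Module k C]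
    [IsScalarTower k C C] [SMulCommClass k C C] {L : QuadraticSubalgebra k C} {e : L} {u : C}
    (hu : u ∈ peirce k (e : C)) :
    ((1 - e : L) : C) * u = u :=
  (sub_mul (1 : C) e u).trans (by rw [one_mul, hu.1, sub_zero])

/-- For u = ue = (1 - e)u, the pairings with e and with 1 - e are N(1, u) times N(e) and N(1 - e),
both zero. -/
theorem peirce_le_perp {e : L} (he : e * e = e) (he0 : e ≠ 0) (he1 : e ≠ 1) :
    peirce k (e : C) ≤ L.perp := by
  intro u hu a
  have heN := norm_eq_zero_of_idempotent he he0 he1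
  have heN' : norm (k := k) ((1 - e : L) : C) = 0 := by
    rw [← conj_of_idempotent he he0 he1, norm_conj, heN]
  have h1 := CompositionAlgebra.bilin_mul_mul_right (k := k) (e : C) 1 u
  have h3 := CompositionAlgebra.bilin_mul_mul (k := k) ((1 - e : L) : C) 1 u
  rw [one_mul, hu.2, heN, mul_zero] at h1
  rw [mul_one, sub_mul_of_mem_peirce hu, heN', zero_mul] at h3
  obtain ⟨α, β, rfl⟩ := exists_eq_smul_idempotent he he0 he1 a
  change bilin k (α • (e : C) + β • ((1 - e : L) : C)) u = 0
  rw [map_add, map_smul, map_smul, LinearMap.add_apply, LinearMap.smul_apply,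
    LinearMap.smul_apply, h1, h3, smul_zero, smul_zero, add_zero]

variable [Algebra.Etale k L]

variable (L) in
theorem exists_eq_add_mem_perp (h2 : (2 : k) ≠ 0) (x : C) :
    ∃ a : L, ∃ y ∈ L.perp, x = a + y := by
  obtain ⟨v, hv, hvN⟩ := L.exists_mem_perp h2
  obtain ⟨b, hb, hbv, hbN⟩ := L.exists_mem_perp_isOrtho h2 hv hvN
  obtain ⟨a₀, a₁, a₂, a₃, h⟩ := exists_eq_add_add h2 hv hb hbv hvN hbN x
  refine ⟨a₀, a₁ * v + a₂ * b + a₃ * (v * b), L.perp.add_mem (L.perp.add_mem (L.mul_mem_perp _ hv)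
      (L.mul_mem_perp _ hb)) (L.mul_mem_perp _ (mul_mem_perp_of_isOrtho hv hbv)), ?_⟩
  rw [h]; abel

theorem eq_of_add_eq_add (h2 : (2 : k) ≠ 0) {a b : L} {x y : C} (hx : x ∈ L.perp)
    (hy : y ∈ L.perp) (h : (a : C) + x = b + y) : x = y := by
  have h1 : ((b - a : L) : C) = x - y := by
    change (b : C) - a = x - y
    rw [sub_eq_sub_iff_add_eq_add, ← h, add_comm]
  have h3 : b - a = 0 := L.eq_zero_of_bilin h2 fun c => by
    rw [h1, bilin_comm]
    exact L.perp.sub_mem hx hy c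
  rw [h3] at h1
  exact sub_eq_zero.mp h1.symm

theorem perp_component_apply (h2 : (2 : k) ≠ 0)
    (ht : ∀ a : L, (t : C ≃ₗ[k] C) (a : C) = a) {a c : L} {x y : C} (hy : y ∈ L.perp)
    (hx : x = a + y) (htx : (t : C ≃ₗ[k] C) x = c * x) : (t : C ≃ₗ[k] C) y = c * y := by
  rw [hx, map_add, ht, mul_add, ← coe_mul] at htx
  exact eq_of_add_eq_add h2 (map_mem_perp ht hy) (L.mul_mem_perp c hy) htx

/-- For a semisimple automorphism, generalized eigenvectors over `L` are eigenvectors. -/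
theorem apply_sub_mul_eq_zero (h2 : (2 : k) ≠ 0)
    (hss : IsGeometricallySemisimple ((t : C ≃ₗ[k] C) : C →ₗ[k] C))
    (ht : ∀ a : L, (t : C ≃ₗ[k] C) (a : C) = a) {c : L} {x y : C}
    (hy : y = (t : C ≃ₗ[k] C) x - c * x) (hty : (t : C ≃ₗ[k] C) y = c * y) : y = 0 := by
  have := OctonionAlgebra.finite k C
  set f : C →ₗ[k] C := ((t : C ≃ₗ[k] C) : C →ₗ[k] C) with hf
  have hfa : ∀ z, f z = (t : C ≃ₗ[k] C) z := fun _ => rfl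
  obtain ⟨i, hi, hiN⟩ := L.exists_pure h2
  obtain ⟨α, β, hc⟩ := L.exists_eq_smul_add h2 hi hiN c
  by_cases hβ : β = 0
  · have hcx : ∀ z : C, (c : C) * z = α • z := by
      intro z
      rw [hc, hβ, zero_smul, add_zero, smul_mul_assoc, one_mul]
    have hp : ∀ z, Polynomial.aeval f (Polynomial.X - Polynomial.C α) z =
        (t : C ≃ₗ[k] C) z - c * z := by
      intro z
      rw [hcx, map_sub, Polynomial.aeval_X, Polynomial.aeval_C, LinearMap.sub_apply,
        Module.algebraMap_end_apply, hfa]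
    rw [hy, ← hp]
    refine hss.aeval_apply_eq_zero _ ?_
    rw [hp, hp x, ← hy, hty, sub_self]
  -- For nonscalar c the map t - c is not a polynomial in t over k, so the polynomial X² - T(c)X +
  -- N(c) is used instead. Here p(t) = (t - c̄)(t - c), and p(t)x = (2c - T(c))y = 2βiy is killed by
  -- p(t), hence zero.
  · let p : Polynomial k := Polynomial.X ^ 2 - Polynomial.C (bilin k (c : C) 1) * Polynomial.X +
      Polynomial.C (norm (k := k) (c : C))
    have hp : ∀ z, Polynomial.aeval f p z = (t : C ≃ₗ[k] C) ((t : C ≃ₗ[k] C) z) -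
        bilin k (c : C) 1 • (t : C ≃ₗ[k] C) z + norm (k := k) (c : C) • z := by
      intro z
      simp only [p, map_add, map_sub, map_mul, Polynomial.aeval_X, Polynomial.aeval_C,
        LinearMap.add_apply, LinearMap.sub_apply, Module.End.mul_apply, pow_two,
        Module.algebraMap_end_apply, hfa]
    have hpx : Polynomial.aeval f p x =
        (t : C ≃ₗ[k] C) y - bilin k (c : C) 1 • y + c * y := by
      rw [hp, hy, map_sub, map_mul_of_fixes ht, mul_sub, mul_mul_eq_smul]
      module
    have hpy : Polynomial.aeval f p y = 0 := by
      rw [hp, hty, map_mul_of_fixes ht, hty, mul_mul_eq_smul]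
      module
    have htc : ∀ z, Polynomial.aeval f p ((c : C) * z) = c * Polynomial.aeval f p z := by
      intro z
      rw [hp, hp, map_mul_of_fixes ht, map_mul_of_fixes ht, mul_add, mul_sub, mul_smul_comm,
        mul_smul_comm]
    have h1 : Polynomial.aeval f p x = 0 := by
      refine hss.aeval_apply_eq_zero _ ?_
      rw [hpx, hty, map_add, map_sub, map_smul, htc, hpy, mul_zero, smul_zero, sub_zero, add_zero]
    have hT : bilin k (c : C) 1 = α * 2 := by
      rw [hc, map_add, map_smul, map_smul, LinearMap.add_apply, LinearMap.smul_apply,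
        LinearMap.smul_apply, hi, smul_zero, add_zero, bilin_one_one, smul_eq_mul]
    have hcy : (c : C) * y = α • y + β • ((i : C) * y) := by
      rw [hc, add_mul, smul_mul_assoc, smul_mul_assoc, one_mul]
    have h3 : (2 * β) • ((i : C) * y) = 0 := by
      rw [hpx, hty, hT, hcy] at h1
      linear_combination (norm := module) h1
    exact eq_zero_of_mul_eq_zero hiN ((smul_eq_zero.mp h3).resolve_left (mul_ne_zero h2 hβ))

/-- Pairing of eigenvectors of a semisimple automorphism. -/
theorem exists_eigenvector_bilin_ne_zero (h2 : (2 : k) ≠ 0)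
    (hss : IsGeometricallySemisimple ((t : C ≃ₗ[k] C) : C →ₗ[k] C))
    (ht : ∀ a : L, (t : C ≃ₗ[k] C) (a : C) = a) {c : L} (hcN : norm (k := k) (c : C) ≠ 0) {x : C}
    (hx : x ≠ 0) (htx : (t : C ≃ₗ[k] C) x = c * x) :
    ∃ w : C, bilin k x w ≠ 0 ∧
      (t : C ≃ₗ[k] C) w = (((norm (k := k) (c : C))⁻¹ • c : L) : C) * w := by
  have := OctonionAlgebra.finite k C
  let D : C →ₗ[k] C := ((t : C ≃ₗ[k] C) : C →ₗ[k] C) - LinearMap.mulLeft k (c : C)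
  have hD : ∀ z, D z = (t : C ≃ₗ[k] C) z - c * z := fun _ => rfl
  have hrefl : (bilin k (C := C)).IsRefl := fun y z h => by rw [bilin_comm, h]
  -- By semisimplicity x is not in the image of t - c, which equals its double orthogonal, so some w
  -- orthogonal to this image pairs nontrivially with x. Orthogonality to the image means t⁻¹w =
  -- c̄w, that is t w = N(c)⁻¹cw.
  have hdd := LinearMap.BilinForm.orthogonal_orthogonal (B := bilin k (C := C))
    (CompositionAlgebra.nondegenerate) hrefl (LinearMap.range D)
  have hxD : x ∉ LinearMap.range D := by
    rintro ⟨y, rfl⟩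
    exact hx (apply_sub_mul_eq_zero h2 hss ht (hD y) htx)
  rw [← hdd, LinearMap.BilinForm.mem_orthogonal_iff] at hxD
  push Not at hxD
  obtain ⟨w, hw, hwx⟩ := hxD
  rw [LinearMap.BilinForm.mem_orthogonal_iff] at hw
  refine ⟨w, fun h => hwx (hrefl _ _ h), ?_⟩
  have h1 : w = (L.conj c : C) * (t : C ≃ₗ[k] C) w := by
    rw [← map_mul_of_fixes ht]
    refine eq_of_bilin (k := k) fun z => ?_
    have h3 := hw (D ((t : C ≃ₗ[k] C).symm z)) ⟨_, rfl⟩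
    change bilin k (D ((t : C ≃ₗ[k] C).symm z)) w = 0 at h3
    rw [hD, LinearEquiv.apply_symm_apply, map_sub, LinearMap.sub_apply, bilin_mul_conj,
      ← bilin_apply_apply t _ ((L.conj c : C) * w), LinearEquiv.apply_symm_apply] at h3
    rw [bilin_comm, sub_eq_zero.mp h3, bilin_comm]
  have h3 : (c : C) * w = norm (k := k) (c : C) • (t : C ≃ₗ[k] C) w := by
    nth_rw 1 [h1]
    rw [← L.mul_mul, ← coe_mul, mul_conj]
    exact (smul_mul_assoc _ _ _).trans (by rw [coe_one, one_mul])
  refine Eq.symm ((smul_mul_assoc (norm (k := k) (c : C))⁻¹ (c : C) w).trans ?_)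
  rw [h3, smul_smul, inv_mul_cancel₀ hcN, one_smul]

theorem exists_anisotropic_eigenvector_of_isField (h2 : (2 : k) ≠ 0) (hL : IsField L)
    (hss : IsGeometricallySemisimple ((t : C ≃ₗ[k] C) : C →ₗ[k] C))
    (ht : ∀ a : L, (t : C ≃ₗ[k] C) (a : C) = a) {u : C} {c : L} (hu : u ∈ L.perp) (hu0 : u ≠ 0)
    (htu : (t : C ≃ₗ[k] C) u = c * u) :
    ∃ v ∈ L.perp, norm (k := k) v ≠ 0 ∧ ∃ a : L, (t : C ≃ₗ[k] C) v = a * v := by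
  have hLN : ∀ a : L, norm (k := k) (a : C) = 0 → a = 0 := by
    intro a ha
    have := hL.isDomain
    have h := mul_conj L a
    rw [ha, zero_smul] at h
    rcases mul_eq_zero.mp h with h | h
    · exact h
    · rw [← conj_conj L a, h, ← zero_smul k (0 : L), conj_smul, zero_smul, zero_smul]
  have hc : norm (k := k) (c : C) ≠ 0 := by
    intro h
    rw [hLN c h] at htu
    exact hu0 ((t : C ≃ₗ[k] C).injective (by rw [htu, map_zero]; exact zero_mul u))
  by_cases huN : norm (k := k) u = 0
  swap
  · exact ⟨u, hu, huN, c, htu⟩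
  obtain ⟨w₀, hw₀, htw₀⟩ := exists_eigenvector_bilin_ne_zero h2 hss ht hc hu0 htu
  obtain ⟨a, w, hw, rfl⟩ := L.exists_eq_add_mem_perp h2 w₀
  have htw := perp_component_apply h2 ht hw rfl htw₀
  rw [map_add, bilin_comm, hu, zero_add] at hw₀
  set d : L := (norm (k := k) (c : C))⁻¹ • c
  by_cases hwN : norm (k := k) w = 0
  swap
  · exact ⟨w, hw, hwN, d, htw⟩
  -- Both u and w are isotropic; the L^⊥-component z of uw serves as their cross product. Were N(z)
  -- = 0, then N(l) = N(uw) = 0 and l = 0 as L is a field, whereas uw has trace -N(u, w) ≠ 0.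
  obtain ⟨l, z, hz, hl⟩ := L.exists_eq_add_mem_perp h2 (u * w)
  refine ⟨z, hz, fun hzN => hw₀ ?_, L.conj d * L.conj c, ?_⟩
  · have h := norm_add (k := k) (l : C) z
    rw [← hl, CompositionAlgebra.norm_mul, huN, zero_mul, hzN, hz l, add_zero, add_zero] at h
    have h0 : ((0 : L) : C) = 0 := rfl
    rw [hLN l h.symm, h0, zero_add] at hl
    have h1 := bilin_mul_left (k := k) u w 1
    rw [hl, L.bilin_one_of_mem_perp hz, L.bilin_one_of_mem_perp hu, zero_mul, zero_sub, mul_one,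
      bilin_comm] at h1
    exact neg_eq_zero.mp h1.symm
  -- Since u and w are not orthogonal, conjugate linearity in the first factor fails, but only by an
  -- element of L. This does not affect L^⊥-components.
  · have h1 : ((c : C) * u) * w = L.conj c * (u * w) +
        (bilin k u w • L.conj c - bilin k ((c : C) * u) w • (1 : L) : L) := by
      have hcu := L.mul_mem_perp c hu
      have h3 := mul_add_mul (k := k) ((c : C) * u) w
      have h4 := mul_add_mul (k := k) u w
      rw [L.bilin_one_of_mem_perp hcu, L.bilin_one_of_mem_perp hw, zero_smul, zero_smul,
        L.perp_mul_mul hw] at h3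
      rw [L.bilin_one_of_mem_perp hu, L.bilin_one_of_mem_perp hw, zero_smul, zero_smul] at h4
      have h5 : w * u = -(u * w) - bilin k u w • (1 : C) := by
        linear_combination (norm := module) h4
      rw [h5, mul_sub, mul_neg, mul_smul_comm, mul_one] at h3
      change _ = (L.conj c : C) * (u * w) +
        (bilin k u w • (L.conj c : C) - bilin k ((c : C) * u) w • (1 : C))
      linear_combination (norm := module) h3
    have h3 := congrArg (t : C ≃ₗ[k] C) hl
    rw [autGroup_map_mul, htu, htw, L.perp_mul_mul (L.mul_mem_perp c hu), h1, hl, map_add, ht,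
      mul_add, mul_add, mul_add, ← L.mul_mul, ← L.mul_mul, ← coe_mul, ← coe_mul, ← coe_mul] at h3
    set e₁ : L := L.conj d * L.conj c * l
    set e₂ : L := L.conj d * (bilin k u w • L.conj c - bilin k ((c : C) * u) w • (1 : L))
    refine (eq_of_add_eq_add h2 (a := e₁ + e₂) (b := l) (L.mul_mem_perp _ hz)
      (map_mem_perp ht hz) ?_).symm
    rw [← h3]
    change (e₁ : C) + e₂ + _ = _
    abel

/-- Vectors of a single Peirce component are isotropic, so u is paired with an eigenvector w of the
opposite component. The sum has norm N(u, w) ≠ 0, and the two scalar eigenvalues combine into one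
eigenvalue c(1 - e) + μe in L. -/
theorem exists_anisotropic_eigenvector_of_idempotent (h2 : (2 : k) ≠ 0) {e : L} (he : e * e = e)
    (he0 : e ≠ 0) (he1 : e ≠ 1)
    (hss : IsGeometricallySemisimple ((t : C ≃ₗ[k] C) : C →ₗ[k] C))
    (ht : ∀ a : L, (t : C ≃ₗ[k] C) (a : C) = a) {u : C} {c : k} (hu : u ∈ peirce k (e : C))
    (hu0 : u ≠ 0) (htu : (t : C ≃ₗ[k] C) u = c • u) :
    ∃ v ∈ L.perp, norm (k := k) v ≠ 0 ∧ ∃ a : L, (t : C ≃ₗ[k] C) v = a * v := by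
  have hc : c ≠ 0 := by
    rintro rfl
    exact hu0 ((t : C ≃ₗ[k] C).injective (by rw [htu, zero_smul, map_zero]))
  have hsm : ∀ (α : k) (x : C), ((α • (1 : L) : L) : C) * x = α • x := by
    intro α x
    exact (smul_mul_assoc α (1 : C) x).trans (by rw [one_mul])
  have hce := conj_of_idempotent he he0 he1
  have heN := norm_eq_zero_of_idempotent he he0 he1
  have heN' : norm (k := k) ((1 - e : L) : C) = 0 := by rw [← hce, norm_conj, heN]
  have hsub : ∀ x : C, ((1 - e : L) : C) * x = x - e * x := by
    intro x
    exact (sub_mul (1 : C) e x).trans (by rw [one_mul])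
  have hu' : ((1 - e : L) : C) * u = u := sub_mul_of_mem_peirce hu
  have huN : norm (k := k) u = 0 := by rw [← hu', CompositionAlgebra.norm_mul, heN', zero_mul]
  have hup : u ∈ L.perp := peirce_le_perp he he0 he1 hu
  have hcN : norm (k := k) ((c • (1 : L) : L) : C) ≠ 0 := by
    have h1 : ((c • (1 : L) : L) : C) = c • (1 : C) := rfl
    rw [h1, CompositionAlgebra.norm_smul, norm_one, mul_one]
    exact mul_ne_zero hc hc
  obtain ⟨w₀, hw₀, htw₀⟩ := exists_eigenvector_bilin_ne_zero h2 hss ht hcN hu0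
    (by rw [hsm, htu])
  rw [smul_smul] at htw₀
  set μ : k := (norm (k := k) ((c • (1 : L) : L) : C))⁻¹ * c
  -- Multiplication by e keeps the eigenvalue and the pairing, as N(u, ew₀) = N((1 - e)u, w₀) = N(u,
  -- w₀).
  have htw₁ : (t : C ≃ₗ[k] C) ((e : C) * w₀) = ((μ • (1 : L) : L) : C) * ((e : C) * w₀) := by
    rw [map_mul_of_fixes ht, htw₀, hsm, hsm, mul_smul_comm]
  have huw₁ : bilin k u ((e : C) * w₀) ≠ 0 := by
    rwa [bilin_mul_eq, hce, hu']
  obtain ⟨a, w, hw, hw₁⟩ := L.exists_eq_add_mem_perp h2 ((e : C) * w₀)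
  have htw := perp_component_apply h2 ht hw hw₁ htw₁
  have hew : (e : C) * w = w := by
    have h1 := congrArg ((e : C) * ·) hw₁
    simp only [mul_add] at h1
    rw [← L.mul_mul, ← coe_mul, he, hw₁, ← coe_mul] at h1
    exact (eq_of_add_eq_add h2 hw (L.mul_mem_perp e hw) h1).symm
  have huw : bilin k u w ≠ 0 := by
    rwa [hw₁, map_add, bilin_comm, hup, zero_add] at huw₁
  have hwN : norm (k := k) w = 0 := by rw [← hew, CompositionAlgebra.norm_mul, heN, zero_mul]
  refine ⟨u + w, L.perp.add_mem hup hw, ?_, c • (1 - e) + μ • e, ?_⟩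
  · rwa [norm_add, huN, hwN, zero_add, zero_add]
  · rw [map_add, htu, htw, hsm]
    change _ = (c • ((1 - e : L) : C) + μ • (e : C)) * (u + w)
    rw [add_mul, smul_mul_assoc, smul_mul_assoc, mul_add, mul_add, hu', hu.1, hsub w, hew]
    module

end eigenvector

/-! ### Ranks of L^⊥ and of the Peirce component -/

section dimension

variable {k C : Type*} [Field k] [NonAssocRing C] [Module k C]
  [IsScalarTower k C C] [SMulCommClass k C C] [OctonionAlgebra k C]
  (L : QuadraticSubalgebra k C) [Algebra.Etale k L]

theorem nontrivial_perp (h2 : (2 : k) ≠ 0) : Nontrivial L.perp := by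
  obtain ⟨v, hv, hvN⟩ := L.exists_mem_perp h2
  refine ⟨⟨⟨v, hv⟩, 0, fun h => hvN ?_⟩⟩
  rw [show v = 0 from congrArg Subtype.val h, QuadraticMap.map_zero]

theorem finrank_perp_le (h2 : (2 : k) ≠ 0) (hL : IsField L) : Module.finrank L L.perp ≤ 3 := by
  have := hL.isDomain
  obtain ⟨v, hv, hvN⟩ := L.exists_mem_perp h2
  obtain ⟨b, hb, hbv, hbN⟩ := L.exists_mem_perp_isOrtho h2 hv hvN
  let s : Fin 3 → L.perp := ![⟨v, hv⟩, ⟨b, hb⟩, ⟨v * b, mul_mem_perp_of_isOrtho hv hbv⟩]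
  have hs : Submodule.span L (Set.range s) = ⊤ := by
    rw [eq_top_iff]
    intro x _
    obtain ⟨a₁, a₂, a₃, h⟩ := exists_eq_add_add_of_mem_perp h2 hv hb hbv hvN hbN x.2
    have hx : x = a₁ • s 0 + a₂ • s 1 + a₃ • s 2 := Subtype.ext h
    rw [hx]
    have hm : ∀ j, s j ∈ Submodule.span L (Set.range s) := fun j =>
      Submodule.subset_span ⟨j, rfl⟩
    exact Submodule.add_mem _ (Submodule.add_mem _ (Submodule.smul_mem _ _ (hm 0))
      (Submodule.smul_mem _ _ (hm 1))) (Submodule.smul_mem _ _ (hm 2))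
  have h5 := finrank_range_le_card (R := L) s
  rwa [Set.finrank, hs, finrank_top, Fintype.card_fin] at h5

variable {L}

theorem nontrivial_peirce (h2 : (2 : k) ≠ 0) {e : L} (he : e * e = e) (he0 : e ≠ 0)
    (he1 : e ≠ 1) : Nontrivial (peirce k (e : C)) := by
  obtain ⟨v, hv, hvN⟩ := L.exists_mem_perp h2
  have hce := conj_of_idempotent he he0 he1
  have h1 : e * (1 - e) = 0 := by rw [mul_sub, mul_one, he, sub_self]
  have h3 : (1 - e) * (1 - e) = 1 - e := by linear_combination he
  have hm : ((1 - e : L) : C) * v ∈ peirce k (e : C) := by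
    refine ⟨?_, ?_⟩
    · rw [← L.mul_mul, ← coe_mul, h1]
      exact zero_mul v
    · rw [L.perp_mul (L.mul_mem_perp _ hv), hce, ← L.mul_mul, ← coe_mul, h3]
  refine ⟨⟨⟨_, hm⟩, 0, fun h => hvN ?_⟩⟩
  have h4 : ((1 - e : L) : C) * v = 0 := congrArg Subtype.val h
  have h5 : v = (e : C) * v := by
    have h6 : ((1 - e : L) : C) * v = v - e * v := (sub_mul (1 : C) e v).trans (by rw [one_mul])
    rw [h6] at h4
    exact sub_eq_zero.mp h4
  rw [h5, CompositionAlgebra.norm_mul, norm_eq_zero_of_idempotent he he0 he1, zero_mul]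

theorem finrank_peirce_le (h2 : (2 : k) ≠ 0) {e : L} (he : e * e = e) (he0 : e ≠ 0)
    (he1 : e ≠ 1) : Module.finrank k (peirce k (e : C)) ≤ 3 := by
  have := OctonionAlgebra.finite k C
  obtain ⟨v, hv, hvN⟩ := L.exists_mem_perp h2
  obtain ⟨b, hb, hbv, hbN⟩ := L.exists_mem_perp_isOrtho h2 hv hvN
  let s : Fin 3 → C := ![((1 - e : L) : C) * v, ((1 - e : L) : C) * b, ((1 - e : L) : C) * (v * b)]
  have hs : peirce k (e : C) ≤ Submodule.span k (Set.range s) := by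
    intro x hx
    obtain ⟨a₁, a₂, a₃, h⟩ := exists_eq_add_add_of_mem_perp h2 hv hb hbv hvN hbN
      (peirce_le_perp he he0 he1 hx)
    have hm : ∀ (j : Fin 3) (a : L) (y : C), ((1 - e : L) : C) * y = s j →
        ((1 - e : L) : C) * (a * y) ∈ Submodule.span k (Set.range s) := by
      intro j a y hy
      obtain ⟨α, β, rfl⟩ := exists_eq_smul_idempotent he he0 he1 a
      have h1 : (1 - e) * (α • e + β • (1 - e)) = β • (1 - e) := by
        rw [mul_add, mul_smul_comm, mul_smul_comm,
          show (1 - e) * e = 0 by rw [sub_mul, one_mul, he, sub_self],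
          show (1 - e) * (1 - e) = 1 - e by linear_combination he, smul_zero, zero_add]
      rw [← L.mul_mul, ← coe_mul, h1]
      change β • ((1 - e : L) : C) * y ∈ _
      rw [smul_mul_assoc, hy]
      exact Submodule.smul_mem _ _ (Submodule.subset_span ⟨j, rfl⟩)
    rw [← sub_mul_of_mem_peirce hx, h, mul_add, mul_add]
    exact Submodule.add_mem _ (Submodule.add_mem _ (hm 0 _ _ rfl) (hm 1 _ _ rfl)) (hm 2 _ _ rfl)
  have h5 := finrank_range_le_card (R := k) s
  rw [Fintype.card_fin] at h5
  exact (Submodule.finrank_mono hs).trans h5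

end dimension

end QuadraticSubalgebra

theorem theorem6p2 {k C : Type*} [Field k] (h2 : (2 : k) ≠ 0)
    [NonAssocRing C] [Module k C] [IsScalarTower k C C] [SMulCommClass k C C]
    [OctonionAlgebra k C]
    (L : QuadraticSubalgebra k C) [Algebra.Etale k L]
    (t₀ : L.fixingSubgroup)
    (hss : CompositionAlgebra.IsGeometricallySemisimple
      ((t₀ : C ≃ₗ[k] C) : C →ₗ[k] C))
    (hred :
      (∃ hL : IsField L, ¬ Irreducible (L.charpolyPerp hL t₀)) ∨
      (∃ e : L, e * e = e ∧ e ≠ 0 ∧ e ≠ 1 ∧ ¬ Irreducible (L.charpolyPeirce t₀ e))) :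
    (∃ g h : CompositionAlgebra.autGroup k C,
        g ^ 2 = 1 ∧ h ^ 2 = 1 ∧ (t₀ : CompositionAlgebra.autGroup k C) = g * h) ∧
      IsConj (t₀ : CompositionAlgebra.autGroup k C)
        (t₀ : CompositionAlgebra.autGroup k C)⁻¹ := by
  have key : ∃ ρ : CompositionAlgebra.autGroup k C, ρ ^ 2 = 1 ∧
      ((t₀ : CompositionAlgebra.autGroup k C) * ρ) ^ 2 = 1 := by
    rcases hred with ⟨hL, hirr⟩ | ⟨e, he, he0, he1, hirr⟩
    · have := L.nontrivial_perp h2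
      have := hL.isDomain
      have := L.free_perp hL
      obtain ⟨c, u, hu0, hu⟩ := LinearMap.exists_apply_eq_smul_of_not_irreducible_charpoly
        (L.restrictPerp t₀) (L.finrank_perp_le h2 hL) hirr
      obtain ⟨v, hv, hvN, a, htv⟩ :=
        QuadraticSubalgebra.exists_anisotropic_eigenvector_of_isField h2 hL hss t₀.2 u.2
          (fun h => hu0 (Subtype.ext h)) (congrArg Subtype.val hu)
      exact QuadraticSubalgebra.exists_inverting_involution_of_eigenvector h2 (Or.inl hL) t₀.2 hv
        hvN htv
    · have := OctonionAlgebra.finite k C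
      have := QuadraticSubalgebra.nontrivial_peirce h2 he he0 he1
      obtain ⟨c, u, hu0, hu⟩ := LinearMap.exists_apply_eq_smul_of_not_irreducible_charpoly
        (L.restrictPeirce t₀ e) (QuadraticSubalgebra.finrank_peirce_le h2 he he0 he1) hirr
      obtain ⟨v, hv, hvN, a, htv⟩ :=
        QuadraticSubalgebra.exists_anisotropic_eigenvector_of_idempotent h2 he he0 he1 hss t₀.2 u.2
          (fun h => hu0 (Subtype.ext h)) (congrArg Subtype.val hu)
      exact QuadraticSubalgebra.exists_inverting_involution_of_eigenvector h2
        (Or.inr ⟨e, he, he0, he1⟩) t₀.2 hv hvN htv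
  obtain ⟨ρ, hρ, htρ⟩ := key
  rw [pow_two] at hρ
  refine ⟨⟨t₀ * ρ, ρ, htρ, by rw [pow_two, hρ], by rw [mul_assoc, hρ, mul_one]⟩, ?_⟩
  rw [isConj_iff]
  refine ⟨ρ, ?_⟩
  rw [pow_two] at htρ
  rw [inv_eq_of_mul_eq_one_left hρ, eq_comm, inv_eq_iff_mul_eq_one]
  simpa only [mul_assoc] using htρ
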